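/- \textbf{Conventions.} A crossed module $(H,G,\mu)$ is a homomorphism of groups $\mu\colon H\to G$ with an action of $G$ on $H$ such that $\mu({}^gh)=g\mu(h)g^{-1}$ and ${}^{\mu(h)}h'=hh'h^{-1}$. It is \emph{abelian} if $G$ and $H$ are abelian and $G$ acts trivially on $H$. It is \emph{free over} $\mathsf{Set}$ if it is the value at some set $S$ of the left adjoint of the forgetful functor $(H,G,\mu)\mapsto H\times G$ from crossed modules to sets, i.e. if there is a map $S\to H\times G$ through which every map from $S$ to the underlying set of a crossed module extends uniquely to a morphism of crossed modules. An action of $(H,G,\mu)$ on $(M,P,\nu)$ consists of actions of the group $G$ on the groups $M$ and $P$ and a map $\xi\colon H\times P\to M$ such that, for all $g\in G$, $h,h'\in H$, $p,p'\in P$, $m\in M$ (with $H$ acting through $\mu$), $\nu({}^gm)={}^g\nu(m)$, ${}^g({}^pm)={}^{({}^gp)}({}^gm)$, $\nu\xi(h,p)={}^{\mu(h)}p\,p^{-1}$, $\xi(h,\nu(m))={}^{\mu(h)}m\,m^{-1}$, ${}^g\xi(h,p)=\xi({}^gh,{}^gp)$, $\xi(hh',p)={}^{\mu(h)}\xi(h',p)\,\xi(h,p)$,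 $\xi(h,pp')=\xi(h,p)\,{}^p\xi(h,p')$. The action is trivial if $G$ acts trivially on $M$ and $P$ and $\xi=1$. The nerve $\mathcal N_*(H,G,\mu)$ is the simplicial group with $\mathcal N_n=H\rtimes(\cdots(H\rtimes G)\cdots)$ ($n$ factors $H$), the nerve of the internal category in groups with object group $G$ and arrow group $H\rtimes G$, where $(h,g)$ is an arrow $g\to\mu(h)g$. An action of $(H,G,\mu)$ on $(M,P,\nu)$ induces an action of $\mathcal N_*(H,G,\mu)$ on $\mathcal N_*(M,P,\nu)$ (conjugation in the nerve of the semidirect product): on arrows, $(h,g)$ sends $(m,p)$ to $({}^{\mu(h)g}m\;\xi(h,{}^gp),{}^gp)$. For a group $G$ let $B_m(G)=\mathbb Z(G)^{\otimes(m+1)}$, $m\ge 0$, with differential $$\partial(g_0\otimes\cdots\otimes g_m)=(-1)^m g_0\otimes\cdots\otimes g_{m-1}+\sum_{i=0}^{m-1}(-1)^i g_0\otimes\cdots\otimes g_ig_{i+1}\otimes\cdots\otimes g_m\qquad(m\ge 1)$$ and right action $(g_0\otimes\cdots\otimes g_m)g=g^{-1}g_0\otimes g_1\otimes\cdots\otimes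 g_m$. For a simplicial group $G_*$ acting on an abelian simplicial group $A_*$, let $B(G_*,A_*)$ be the bicomplex of the groups $B_m(G_k)\otimes_{G_k}A_k$ ($m,k\ge0$), with differential $\partial\otimes 1$ in the direction of $m$ and the alternating sum of the face maps $b\otimes a\mapsto d_i(b)\otimes d_i(a)$ in the direction of $k$. For a crossed module $(H,G,\mu)$ acting on an abelian crossed module $(C,A,\nu)$ put $$H_n((H,G,\mu),(C,A,\nu))=H_n\big(\operatorname{Tot}B(\mathcal N_*(H,G,\mu),\mathcal N_*(C,A,\nu))\big),\qquad n\ge0,$$ and let $H_n(H,G,\mu)=H_n((H,G,\mu),(0,\mathbb Z,0))$ for the trivial action on $(0,\mathbb Z,0)$. \textbf{Corollary.} Let $(R,F,\eta)$ be a crossed module that is free over $\mathsf{Set}$. Then (a) for every action of $(R,F,\eta)$ on an abelian crossed module $(C,A,\nu)$, $H_n((R,F,\eta),(C,A,\nu))=0$ for all $n\ge3$; (b) $H_n(R,F,\eta)=0$ for all $n\ge2$. -/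

import Mathlib

open CategoryTheory CategoryTheory.Limits
open scoped TensorProduct

universe u v

/-! ### Crossed modules -/

/-- A crossed module `(H, G, μ)`: a homomorphism `μ : H → G` together with an action of the group
`G` on the group `H` by automorphisms, satisfying the precrossed module and Peiffer identities. -/
structure CrossedModule (H G : Type*) [Group H] [Group G] where
  μ : H →* G
  act : G →* MulAut H
  precrossed : ∀ (g : G) (h : H), μ (act g h) = g * μ h * g⁻¹
  peiffer : ∀ h h' : H, act (μ h) h' = h * h' * h⁻¹

namespace CrossedModule

/-- A morphism of crossed modules: a commutative square of groups whose top arrow is equivariant. -/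
@[ext]
structure Hom {H G H' G' : Type*} [Group H] [Group G] [Group H'] [Group G']
    (X : CrossedModule H G) (Y : CrossedModule H' G') where
  top : H →* H'
  bot : G →* G'
  comm : ∀ h, bot (X.μ h) = Y.μ (top h)
  equivariant : ∀ g h, top (X.act g h) = Y.act (bot g) (top h)

/-- `X = (H, G, μ)` is free over `Set`: there are a set `S` and a map `S → H × G` to the underlying
set of `X` through which every map from `S` to the underlying set of a crossed module extends
uniquely to a morphism. That is, `X` is the value at `S` of the left adjoint to the
forgetful functor from crossed modules to sets, `(H, G, μ) ↦ H × G`. -/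
def IsFree {H G : Type u} [Group H] [Group G] (X : CrossedModule H G) : Prop :=
  ∃ (S : Type u) (ι : S → H × G),
    ∀ (H' G' : Type u) [Group H'] [Group G'] (Y : CrossedModule H' G') (k : S → H' × G'),
      ∃! φ : Hom X Y, ∀ s, (φ.top (ι s).1, φ.bot (ι s).2) = k s

/-- A crossed module is abelian if both groups are abelian and the action is trivial. -/
structure IsAbelian {M P : Type*} [Group M] [Group P] (Y : CrossedModule M P) : Prop where
  top_comm : ∀ m m' : M, m * m' = m' * m
  bot_comm : ∀ p p' : P, p * p' = p' * p
  act_trivial : ∀ (p : P) (m : M), Y.act p m = m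

/-- An action of a crossed module `(H, G, μ)` on a crossed module `(M, P, ν)`: actions of the group
`G` on the groups `M` and `P` (on which `H` then acts through `μ`) and a map `ξ : H × P → M`. -/
structure Action {H G M P : Type*} [Group H] [Group G] [Group M] [Group P]
    (X : CrossedModule H G) (Y : CrossedModule M P) where
  actM : G →* MulAut M
  actP : G →* MulAut P
  ξ : H → P → M
  map_actM : ∀ g m, Y.μ (actM g m) = actP g (Y.μ m)
  actM_act : ∀ g p m, actM g (Y.act p m) = Y.act (actP g p) (actM g m)
  map_ξ : ∀ h p, Y.μ (ξ h p) = actP (X.μ h) p * p⁻¹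
  ξ_map : ∀ h m, ξ h (Y.μ m) = actM (X.μ h) m * m⁻¹
  actM_ξ : ∀ g h p, actM g (ξ h p) = ξ (X.act g h) (actP g p)
  ξ_mul_left : ∀ h h' p, ξ (h * h') p = actM (X.μ h) (ξ h' p) * ξ h p
  ξ_mul_right : ∀ h p p', ξ h (p * p') = ξ h p * Y.act p (ξ h p')

/-- The trivial action: `G` acts trivially on `M` and `P`, and `ξ` is trivial. -/
def Action.trivial {H G M P : Type*} [Group H] [Group G] [Group M] [Group P]
    (X : CrossedModule H G) (Y : CrossedModule M P) : X.Action Y where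
  actM := 1
  actP := 1
  ξ _ _ := 1
  map_actM _ _ := rfl
  actM_act _ _ _ := rfl
  map_ξ _ _ := by simp
  ξ_map _ _ := by simp
  actM_ξ _ _ _ := rfl
  ξ_mul_left _ _ _ := by simp
  ξ_mul_right _ _ _ := by simp

/-- The crossed module `(0, P, 0)` of a group `P`. -/
def ofGroup (P : Type*) [Group P] : CrossedModule PUnit.{1} P where
  μ := 1
  act := 1
  precrossed _ _ := by simp
  peiffer _ _ := rfl

/-- The crossed module `(0, ℤ, 0)`, with the group `ℤ` written multiplicatively. -/
abbrev integers : CrossedModule PUnit.{1} (Multiplicative ℤ) := ofGroup (Multiplicative ℤ)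

lemma isAbelian_integers : integers.IsAbelian where
  top_comm _ _ := rfl
  bot_comm := mul_comm
  act_trivial _ _ := rfl

/-! ### The nerve

The internal category in groups associated with `(H, G, μ)` has `G` as its group of objects and
`H ⋊ G` as its group of arrows; `(h, g)` is an arrow from `g` to `μ h * g`, and the composite of
`(h, g)` with `(h', μ h * g)` is `(h' * h, g)`. An `n`-simplex of its nerve is a string of `n`
composable arrows, and it is recorded here with all its composites.
-/

/-- The `n`-simplices of the nerve of `(H, G, μ)`: vertices `obj i`, and for `i ≤ j` an arrow
`(hom i j, obj j)` from `obj j` to `obj i`, compatible with composition. The string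
`(h₁, …, hₙ, g)` in `H ⋊ (⋯ (H ⋊ G) ⋯)` corresponds to `hᵢ = hom (i - 1) i` and `g = obj n`. -/
@[ext]
structure Nerve {H G : Type*} [Group H] [Group G] (X : CrossedModule H G) (n : ℕ) where
  obj : Fin (n + 1) → G
  hom : ∀ i j : Fin (n + 1), i ≤ j → H
  target : ∀ i j (h : i ≤ j), X.μ (hom i j h) * obj j = obj i
  comp : ∀ i j k (h : i ≤ j) (h' : j ≤ k), hom i j h * hom j k h' = hom i k (h.trans h')

namespace Nerve

section

variable {H G : Type*} [Group H] [Group G] {X : CrossedModule H G} {n : ℕ}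

/-- Multiplication of simplices: arrows are multiplied in `H ⋊ G`. -/
instance : Mul (Nerve X n) where
  mul x y :=
    { obj := fun i => x.obj i * y.obj i
      hom := fun i j h => x.hom i j h * X.act (x.obj j) (y.hom i j h)
      target := fun i j h => by
        rw [map_mul, X.precrossed, ← x.target i j h, ← y.target i j h]; group
      comp := fun i j k h h' => by
        rw [← x.comp i j k h h', ← y.comp i j k h h', ← x.target j k h', map_mul, map_mul,
          MulAut.mul_apply, X.peiffer]
        group }

instance : One (Nerve X n) where
  one :=
    { obj := fun _ => 1
      hom := fun _ _ _ => 1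
      target := fun _ _ _ => by simp
      comp := fun _ _ _ _ _ => by simp }

instance : Inv (Nerve X n) where
  inv x :=
    { obj := fun i => (x.obj i)⁻¹
      hom := fun i j h => X.act (x.obj j)⁻¹ (x.hom i j h)⁻¹
      target := fun i j h => by
        rw [X.precrossed, ← x.target i j h, map_inv]; group
      comp := fun i j k h h' => by
        rw [← x.comp i j k h h', ← x.target j k h', mul_inv_rev, map_mul, MulAut.mul_apply,
          ← map_inv X.μ, X.peiffer, ← map_mul]
        group }

@[simp] lemma mul_obj (x y : Nerve X n) (i) : (x * y).obj i = x.obj i * y.obj i := rfl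

@[simp] lemma mul_hom (x y : Nerve X n) (i j h) :
    (x * y).hom i j h = x.hom i j h * X.act (x.obj j) (y.hom i j h) := rfl

@[simp] lemma one_obj (i) : (1 : Nerve X n).obj i = 1 := rfl

@[simp] lemma one_hom (i j h) : (1 : Nerve X n).hom i j h = 1 := rfl

@[simp] lemma inv_obj (x : Nerve X n) (i) : (x⁻¹).obj i = (x.obj i)⁻¹ := rfl

@[simp] lemma inv_hom (x : Nerve X n) (i j h) :
    (x⁻¹).hom i j h = X.act (x.obj j)⁻¹ (x.hom i j h)⁻¹ := rfl

instance : Group (Nerve X n) :=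
  Group.ofLeftAxioms
    (fun x y z => by ext <;> simp [mul_assoc])
    (fun x => by ext <;> simp)
    (fun x => by ext <;> simp)

/-- The nerve of an abelian crossed module consists of abelian groups. -/
abbrev commGroup (hX : X.IsAbelian) (n : ℕ) : CommGroup (Nerve X n) :=
  { (inferInstance : Group (Nerve X n)) with
    mul_comm := fun x y => by
      ext
      · simp [hX.bot_comm]
      · simp [hX.act_trivial, hX.top_comm] }

/-- The homomorphism of groups induced by a monotone map. -/
def map {m n : ℕ} (f : Fin (m + 1) →o Fin (n + 1)) : Nerve X n →* Nerve X m where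
  toFun x :=
    { obj := fun i => x.obj (f i)
      hom := fun i j h => x.hom (f i) (f j) (f.monotone h)
      target := fun _ _ _ => x.target _ _ _
      comp := fun _ _ _ _ _ => x.comp _ _ _ _ _ }
  map_one' := rfl
  map_mul' _ _ := rfl

@[simp] lemma map_obj {m n : ℕ} (f : Fin (m + 1) →o Fin (n + 1)) (x : Nerve X n) (i) :
    (map f x).obj i = x.obj (f i) := rfl

@[simp] lemma map_hom {m n : ℕ} (f : Fin (m + 1) →o Fin (n + 1)) (x : Nerve X n) (i j h) :
    (map f x).hom i j h = x.hom (f i) (f j) (f.monotone h) := rfl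

end

end Nerve

/-- The nerve of a crossed module, as a simplicial group. -/
def nerve {H G : Type u} [Group H] [Group G] (X : CrossedModule H G) :
    SimplicialObject GrpCat.{u} where
  obj n := GrpCat.of (Nerve X n.unop.len)
  map f := GrpCat.ofHom (Nerve.map f.unop.toOrderHom)
  map_id _ := rfl
  map_comp _ _ := rfl

/-- The nerve of an abelian crossed module, as an abelian simplicial group (written additively). -/
def abelianNerve {M P : Type u} [Group M] [Group P] (Y : CrossedModule M P) (hY : Y.IsAbelian) :
    SimplicialObject AddCommGrpCat.{u} where
  obj n :=
    letI := Nerve.commGroup hY n.unop.len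
    AddCommGrpCat.of (Additive (Nerve Y n.unop.len))
  map f :=
    letI := Nerve.commGroup hY
    AddCommGrpCat.ofHom (MonoidHom.toAdditive (Nerve.map f.unop.toOrderHom))
  map_id _ := rfl
  map_comp _ _ := rfl

section

variable {H G M P : Type*} [Group H] [Group G] [Group M] [Group P]
  {X : CrossedModule H G} {Y : CrossedModule M P}

lemma Action.ξ_map_mul (a : X.Action Y) (h : H) (m : M) (p : P) :
    a.ξ h (Y.μ m * p) = a.actM (X.μ h) m * a.ξ h p * m⁻¹ := by
  rw [a.ξ_mul_right, a.ξ_map, Y.peiffer]; group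

lemma Action.ξ_one_right (a : X.Action Y) (h : H) : a.ξ h 1 = 1 := by
  simpa using a.ξ_map h 1

lemma Action.ξ_one_left (a : X.Action Y) (p : P) : a.ξ 1 p = 1 := by
  simpa using a.ξ_mul_left 1 1 p

/-- The action of the simplices of the nerve of `X` on those of the nerve of `Y` induced by an action
of `X` on `Y`. It is conjugation in the nerve of the semidirect product `Y ⋊ X`: an arrow `(h, g)`
sends an arrow `(m, p)` to `(^{μ(h)g}m * ξ(h, ^g p), ^g p)`. -/
def Action.nerveAct (a : X.Action Y) (n : ℕ) : Nerve X n →* Monoid.End (Nerve Y n) where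
  toFun x :=
    { toFun := fun y =>
        { obj := fun i => a.actP (x.obj i) (y.obj i)
          hom := fun i j h =>
            a.actM (x.obj i) (y.hom i j h) * a.ξ (x.hom i j h) (a.actP (x.obj j) (y.obj j))
          target := fun i j h => by
            rw [← x.target i j h, ← y.target i j h]
            simp [a.map_actM, a.map_ξ, mul_assoc]
          comp := fun i j k h h' => by
            have e : a.actP (x.obj j) (y.obj j) =
                Y.μ (a.actM (x.obj j) (y.hom j k h') *
                  a.ξ (x.hom j k h') (a.actP (x.obj k) (y.obj k))) *
                  a.actP (x.obj k) (y.obj k) := by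
              rw [← x.target j k h', ← y.target j k h']
              simp [a.map_actM, a.map_ξ, mul_assoc]
            rw [e, a.ξ_map_mul, ← x.comp i j k h h', ← y.comp i j k h h', a.ξ_mul_left,
              ← x.target i j h]
            simp [mul_assoc] }
      map_one' := by
        ext <;> simp [a.ξ_one_right]
      map_mul' := fun y z => by
        ext i
        · simp
        · rename_i i j h
          have e : ∀ (c : H) (q : P) (m : M), Y.act (a.actP (X.μ c) q) m * a.ξ c q =
              a.ξ c q * Y.act q m := fun c q m => by
            have e₁ : a.actP (X.μ c) q = Y.μ (a.ξ c q) * q := by rw [a.map_ξ]; group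
            rw [e₁, map_mul, MulAut.mul_apply, Y.peiffer]; group
          have e₂ : a.actM (x.obj i) (Y.act (y.obj j) (z.hom i j h)) =
              Y.act (a.actP (X.μ (x.hom i j h)) (a.actP (x.obj j) (y.obj j)))
                (a.actM (x.obj i) (z.hom i j h)) := by
            rw [a.actM_act, ← x.target i j h, map_mul, MulAut.mul_apply]
          simp only [Nerve.mul_hom, Nerve.mul_obj, map_mul, a.ξ_mul_right, e₂]
          simp only [mul_assoc]
          rw [← mul_assoc (Y.act _ _), e]
          simp only [mul_assoc] }
  map_one' := by
    ext y i
    · change a.actP 1 (y.obj i) = y.obj i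
      simp
    · rename_i i j h
      change a.actM 1 (y.hom i j h) * a.ξ 1 (a.actP 1 (y.obj j)) = y.hom i j h
      simp [a.ξ_one_left]
  map_mul' x x' := by
    ext y i
    · change a.actP (x.obj i * x'.obj i) (y.obj i) = a.actP (x.obj i) (a.actP (x'.obj i) (y.obj i))
      simp
    · rename_i i j h
      change a.actM ((x * x').obj i) (y.hom i j h) *
          a.ξ ((x * x').hom i j h) (a.actP ((x * x').obj j) (y.obj j)) =
        a.actM (x.obj i) (a.actM (x'.obj i) (y.hom i j h) *
          a.ξ (x'.hom i j h) (a.actP (x'.obj j) (y.obj j))) *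
        a.ξ (x.hom i j h) (a.actP (x.obj j) (a.actP (x'.obj j) (y.obj j)))
      simp only [Nerve.mul_hom, Nerve.mul_obj, map_mul, a.ξ_mul_left, MulAut.mul_apply,
        ← x.target i j h, a.actM_ξ]
      simp only [mul_assoc]

end

end CrossedModule

/-! ### The standard resolution of a group -/

section Bar

variable (G : Type u) [Group G]

/-- `B_m(G) = ℤ(G) ⊗ ⋯ ⊗ ℤ(G)` (`m + 1` factors): the free abelian group on the elements
`g₀ ⊗ ⋯ ⊗ g_m`, that is, on the tuples `(g₀, …, g_m)`. -/
abbrev Bar (m : ℕ) : Type u := (Fin (m + 1) → G) →₀ ℤ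

namespace Bar

/-- The `j`-th term of the differential without its sign: it sends `g₀ ⊗ ⋯ ⊗ g_{m+1}` to
`g₀ ⊗ ⋯ ⊗ g_j g_{j+1} ⊗ ⋯ ⊗ g_{m+1}` if `j ≤ m`, and to `g₀ ⊗ ⋯ ⊗ g_m` if `j = m + 1`. -/
noncomputable def face (m : ℕ) (j : Fin (m + 2)) : Bar G (m + 1) →+ Bar G m :=
  Finsupp.mapDomain.addMonoidHom (Fin.contractNth j (· * ·))

/-- The differential of the standard resolution. -/
noncomputable def d (m : ℕ) : Bar G (m + 1) →+ Bar G m :=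
  ∑ j : Fin (m + 2), (-1 : ℤ) ^ (j : ℕ) • face G m j

variable {G}

/-- The right action of `g` on the standard resolution:
`(g₀ ⊗ g₁ ⊗ ⋯ ⊗ g_m) g = g⁻¹ g₀ ⊗ g₁ ⊗ ⋯ ⊗ g_m`. -/
noncomputable def rightMul (m : ℕ) (g : G) : Bar G m →+ Bar G m :=
  Finsupp.mapDomain.addMonoidHom fun x => Fin.cons (g⁻¹ * x 0) (Fin.tail x)

/-- The map of standard resolutions induced by a homomorphism of groups. -/
noncomputable def map {G' : Type u} [Group G'] (f : G →* G') (m : ℕ) : Bar G m →+ Bar G' m :=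
  Finsupp.mapDomain.addMonoidHom fun x => f ∘ x

lemma contractNth_contractNth {m : ℕ} (x : Fin (m + 2) → G) (i j : Fin (m + 1)) (h : i ≤ j) :
    Fin.contractNth i (· * ·) (Fin.contractNth j.succ (· * ·) x) =
      Fin.contractNth j (· * ·) (Fin.contractNth i.castSucc (· * ·) x) := by
  have inj : Function.Injective (Fin.partialProd (M := G) (n := m)) := fun x y e => by
    ext k
    rw [← Fin.partialProd_right_inv x k, ← Fin.partialProd_right_inv y k, e]
  apply inj
  simp only [Fin.partialProd_contractNth]
  ext k
  simp only [Function.comp_apply]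
  congr 1
  ext
  simp only [Fin.succAbove, Fin.lt_def]
  have : (i : ℕ) ≤ j := h
  split_ifs <;> simp_all <;> omega

lemma face_face {m : ℕ} (i j : Fin (m + 2)) (h : i ≤ j) :
    (face G m i).comp (face G (m + 1) j.succ) =
      (face G m j).comp (face G (m + 1) i.castSucc) := by
  ext x : 2
  simp [face, contractNth_contractNth _ _ _ h]

lemma d_comp_d (m : ℕ) : (d G m).comp (d G (m + 1)) = 0 := by
  refine DFunLike.ext _ _ fun b => ?_
  simp only [d, AddMonoidHom.comp_apply, AddMonoidHom.finsetSum_apply, AddMonoidHom.smul_apply,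
    map_sum, map_zsmul, AddMonoidHom.zero_apply, Finset.smul_sum, smul_smul]
  rw [Finset.sum_comm, ← Finset.sum_product', Finset.univ_product_univ,
    ← Finset.sum_filter_add_sum_filter_not Finset.univ
      (fun p : Fin (m + 2) × Fin (m + 3) => (p.2 : ℕ) ≤ p.1),
    ← eq_neg_iff_add_eq_zero, ← Finset.sum_neg_distrib]
  refine Finset.sum_bij
    (fun p hp => (Fin.castLT p.2 (lt_of_le_of_lt (Finset.mem_filter.mp hp).2 p.1.is_lt), p.1.succ))
    ?_ ?_ ?_ ?_
  · rintro ⟨i, j⟩ hp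
    simp only [Finset.mem_filter, Finset.mem_univ, true_and] at hp ⊢
    simp
    omega
  · rintro ⟨i, j⟩ hp ⟨i', j'⟩ hp' h
    simp only [Prod.mk.injEq, Fin.ext_iff, Fin.val_castLT, Fin.val_succ] at h ⊢
    omega
  · rintro ⟨i, j⟩ hp
    simp only [Finset.mem_filter, Finset.mem_univ, true_and, not_le] at hp
    refine ⟨(j.pred (by rintro rfl; simp at hp), i.castSucc), ?_, ?_⟩
    · simp
      omega
    · simp
  · rintro ⟨i, j⟩ hp
    simp only [Finset.mem_filter, Finset.mem_univ, true_and] at hp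
    have := DFunLike.congr_fun (face_face (G := G)
      (Fin.castLT j (lt_of_le_of_lt hp i.is_lt)) i hp) b
    simp only [AddMonoidHom.comp_apply, Fin.castSucc_castLT] at this
    simp only [Fin.val_castLT, Fin.val_succ, this, ← neg_smul]
    congr 1
    ring

lemma rightMul_face (m : ℕ) (j : Fin (m + 2)) (g : G) :
    (face G m j).comp (rightMul (m + 1) g) = (rightMul m g).comp (face G m j) := by
  ext x : 2
  simp only [face, rightMul, AddMonoidHom.comp_apply, Finsupp.mapDomain.addMonoidHom_apply,
    Finsupp.singleAddHom_apply, Finsupp.mapDomain_single]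
  congr 1
  ext k
  refine Fin.cases ?_ (fun k => ?_) k
  · simp only [Fin.contractNth, Fin.cons_zero]
    split_ifs <;> simp_all [mul_assoc, Fin.tail]
  · simp [Fin.contractNth, Fin.tail]

lemma rightMul_d (m : ℕ) (g : G) :
    (d G m).comp (rightMul (m + 1) g) = (rightMul m g).comp (d G m) := by
  refine DFunLike.ext _ _ fun b => ?_
  have := fun j => DFunLike.congr_fun (rightMul_face m j g) b
  simp only [AddMonoidHom.comp_apply] at this
  simp [d, AddMonoidHom.finsetSum_apply, this]

variable {G' : Type u} [Group G']

lemma map_face (f : G →* G') (m : ℕ) (j : Fin (m + 2)) :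
    (face G' m j).comp (map f (m + 1)) = (map f m).comp (face G m j) := by
  ext x : 2
  simp only [face, map, AddMonoidHom.comp_apply, Finsupp.mapDomain.addMonoidHom_apply,
    Finsupp.singleAddHom_apply, Finsupp.mapDomain_single]
  congr 1
  ext k
  simp only [Fin.contractNth, Function.comp_apply]
  split_ifs <;> simp

lemma map_d (f : G →* G') (m : ℕ) :
    (d G' m).comp (map f (m + 1)) = (map f m).comp (d G m) := by
  refine DFunLike.ext _ _ fun b => ?_
  have := fun j => DFunLike.congr_fun (map_face f m j) b
  simp only [AddMonoidHom.comp_apply] at this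
  simp [d, AddMonoidHom.finsetSum_apply, this]

lemma map_rightMul (f : G →* G') (m : ℕ) (g : G) :
    (map f m).comp (rightMul m g) = (rightMul m (f g)).comp (map f m) := by
  ext x : 2
  simp only [rightMul, map, AddMonoidHom.comp_apply, Finsupp.mapDomain.addMonoidHom_apply,
    Finsupp.singleAddHom_apply, Finsupp.mapDomain_single]
  congr 1
  ext k
  refine Fin.cases ?_ (fun k => ?_) k <;> simp [Fin.tail]

end Bar

end Bar

/-! ### The tensor product `B_m(G) ⊗_G A` -/

section BarTensor

variable {G : Type u} [Group G] {A : Type v} [AddCommGroup A]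

/-- The subgroup of `B_m(G) ⊗_ℤ A` generated by the elements `b g ⊗ a - b ⊗ g a`. -/
noncomputable def barTensorRel (φ : G →* AddMonoid.End A) (m : ℕ) : AddSubgroup (Bar G m ⊗[ℤ] A) :=
  AddSubgroup.closure
    {t | ∃ (b : Bar G m) (g : G) (a : A), t = Bar.rightMul m g b ⊗ₜ[ℤ] a - b ⊗ₜ[ℤ] φ g a}

/-- The tensor product `B_m(G) ⊗_G A`, where `G` acts on the abelian group `A` through `φ`. -/
abbrev BarTensor (φ : G →* AddMonoid.End A) (m : ℕ) : Type (max u v) :=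
  (Bar G m ⊗[ℤ] A) ⧸ barTensorRel φ m

namespace BarTensor

/-- The map `f ⊗ g : B_m(G) ⊗_G A → B_n(G') ⊗_{G'} A'` induced by two compatible homomorphisms. -/
noncomputable def lift {G' : Type u} [Group G'] {A' : Type v} [AddCommGroup A']
    {φ : G →* AddMonoid.End A} {φ' : G' →* AddMonoid.End A'} {m n : ℕ}
    (u : G →* G') (f : Bar G m →+ Bar G' n) (k : A →+ A')
    (hf : ∀ g b, f (Bar.rightMul m g b) = Bar.rightMul n (u g) (f b))
    (hk : ∀ g a, k (φ g a) = φ' (u g) (k a)) : BarTensor φ m →+ BarTensor φ' n :=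
  QuotientAddGroup.map _ _
    (TensorProduct.map f.toIntLinearMap k.toIntLinearMap).toAddMonoidHom <| by
    rw [barTensorRel, AddSubgroup.closure_le]
    rintro _ ⟨b, g, a, rfl⟩
    refine AddSubgroup.subset_closure ⟨f b, u g, k a, ?_⟩
    simp [hf, hk]

/-- The map `∂ ⊗ 1 : B_{m+1}(G) ⊗_G A → B_m(G) ⊗_G A`. -/
noncomputable def d (φ : G →* AddMonoid.End A) (m : ℕ) : BarTensor φ (m + 1) →+ BarTensor φ m :=
  lift (MonoidHom.id G) (Bar.d G m) (AddMonoidHom.id A)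
    (fun g b => DFunLike.congr_fun (Bar.rightMul_d m g) b) (fun _ _ => rfl)

/-- The map `B_m(G) ⊗_G A → B_m(G') ⊗_{G'} A'`, `b ⊗ a ↦ f(b) ⊗ k(a)`, induced by a homomorphism
`f : G → G'` and an `f`-equivariant homomorphism `k : A → A'`. -/
noncomputable def map {G' : Type u} [Group G'] {A' : Type v} [AddCommGroup A']
    {φ : G →* AddMonoid.End A} {φ' : G' →* AddMonoid.End A'} (f : G →* G') (k : A →+ A')
    (hk : ∀ g a, k (φ g a) = φ' (f g) (k a)) (m : ℕ) : BarTensor φ m →+ BarTensor φ' m :=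
  lift f (Bar.map f m) k (fun g b => DFunLike.congr_fun (Bar.map_rightMul f m g) b) hk

@[ext]
lemma hom_ext {B : Type*} [AddCommGroup B] {φ : G →* AddMonoid.End A} {m : ℕ}
    {f f' : BarTensor φ m →+ B}
    (h : ∀ (b : Bar G m) (a : A), f (QuotientAddGroup.mk (b ⊗ₜ[ℤ] a)) =
      f' (QuotientAddGroup.mk (b ⊗ₜ[ℤ] a))) : f = f' := by
  ext t
  induction t using TensorProduct.induction_on with
  | zero => simp
  | tmul b a => exact h b a
  | add x y hx hy => simpa using congr($hx + $hy)

@[simp]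
lemma lift_mk {G' : Type u} [Group G'] {A' : Type v} [AddCommGroup A']
    {φ : G →* AddMonoid.End A} {φ' : G' →* AddMonoid.End A'} {m n : ℕ}
    (u : G →* G') (f : Bar G m →+ Bar G' n) (k : A →+ A') (hf hk) (b : Bar G m) (a : A) :
    lift (φ := φ) (φ' := φ') u f k hf hk (QuotientAddGroup.mk (b ⊗ₜ[ℤ] a)) =
      QuotientAddGroup.mk (f b ⊗ₜ[ℤ] k a) := rfl

@[simp]
lemma d_mk (φ : G →* AddMonoid.End A) (m : ℕ) (b : Bar G (m + 1)) (a : A) :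
    d φ m (QuotientAddGroup.mk (b ⊗ₜ[ℤ] a)) = QuotientAddGroup.mk (Bar.d G m b ⊗ₜ[ℤ] a) := rfl

@[simp]
lemma map_mk {G' : Type u} [Group G'] {A' : Type v} [AddCommGroup A']
    {φ : G →* AddMonoid.End A} {φ' : G' →* AddMonoid.End A'} (f : G →* G') (k : A →+ A')
    (hk : ∀ g a, k (φ g a) = φ' (f g) (k a)) (m : ℕ) (b : Bar G m) (a : A) :
    map f k hk m (QuotientAddGroup.mk (b ⊗ₜ[ℤ] a)) =
      QuotientAddGroup.mk (Bar.map f m b ⊗ₜ[ℤ] k a) := rfl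

lemma map_id (φ : G →* AddMonoid.End A) (m : ℕ) (hk) :
    map (φ := φ) (φ' := φ) (MonoidHom.id G) (AddMonoidHom.id A) hk m = AddMonoidHom.id _ := by
  refine hom_ext fun b a => ?_
  have : Bar.map (MonoidHom.id G) m b = b := Finsupp.mapDomain_id
  simp [this]

lemma map_comp {G' G'' : Type u} [Group G'] [Group G''] {A' A'' : Type v} [AddCommGroup A']
    [AddCommGroup A''] {φ : G →* AddMonoid.End A} {φ' : G' →* AddMonoid.End A'}
    {φ'' : G'' →* AddMonoid.End A''} (f : G →* G') (k : A →+ A') (f' : G' →* G'') (k' : A' →+ A'')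
    (hk : ∀ g a, k (φ g a) = φ' (f g) (k a)) (hk' : ∀ g a, k' (φ' g a) = φ'' (f' g) (k' a))
    (hk'' : ∀ g a, k'.comp k (φ g a) = φ'' (f'.comp f g) (k'.comp k a)) (m : ℕ) :
    map (f'.comp f) (k'.comp k) hk'' m = (map f' k' hk' m).comp (map f k hk m) := by
  refine hom_ext fun b a => ?_
  have : Bar.map (f'.comp f) m b = Bar.map f' m (Bar.map f m b) :=
    Finsupp.mapDomain_comp (f := fun x : Fin (m + 1) → G => f ∘ x)
      (g := fun x : Fin (m + 1) → G' => f' ∘ x)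
  simp [this]

lemma map_d {G' : Type u} [Group G'] {A' : Type v} [AddCommGroup A']
    {φ : G →* AddMonoid.End A} {φ' : G' →* AddMonoid.End A'} (f : G →* G') (k : A →+ A')
    (hk : ∀ g a, k (φ g a) = φ' (f g) (k a)) (m : ℕ) :
    (d φ' m).comp (map f k hk (m + 1)) = (map f k hk m).comp (d φ m) := by
  refine hom_ext fun b a => ?_
  have := DFunLike.congr_fun (Bar.map_d f m) b
  simp only [AddMonoidHom.comp_apply] at this
  simp [this]

lemma d_comp_d (φ : G →* AddMonoid.End A) (m : ℕ) : (d φ m).comp (d φ (m + 1)) = 0 := by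
  refine hom_ext fun b a => ?_
  have := DFunLike.congr_fun (Bar.d_comp_d (G := G) m) b
  simp only [AddMonoidHom.comp_apply] at this
  simp [this]

end BarTensor

end BarTensor

/-! ### Homology of simplicial groups and of crossed modules with coefficients -/

/-- An action of a simplicial group `G` on an abelian simplicial group `A`: actions of the groups
`G_n` on the groups `A_n` with which all face and degeneracy maps are compatible. -/
structure SimplicialAction (G : SimplicialObject GrpCat.{u}) (A : SimplicialObject AddCommGrpCat.{v})
    where
  act : ∀ n, G.obj n →* AddMonoid.End (A.obj n)
  map_act : ∀ {n m} (f : n ⟶ m) (g : G.obj n) (a : A.obj n),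
    A.map f (act n g a) = act m (G.map f g) (A.map f a)

namespace SimplicialAction

variable {G : SimplicialObject GrpCat.{u}} {A : SimplicialObject AddCommGrpCat.{v}}
  (α : SimplicialAction G A)

/-- The abelian simplicial group `B_m(G_*, A_*)` with `k`-simplices `B_m(G_k) ⊗_{G_k} A_k`. -/
noncomputable def bar (m : ℕ) : SimplicialObject AddCommGrpCat.{max u v} where
  obj k := AddCommGrpCat.of (BarTensor (α.act k) m)
  map f := AddCommGrpCat.ofHom (BarTensor.map (G.map f).hom (A.map f).hom (α.map_act f) m)
  map_id k := by
    simp only [CategoryTheory.Functor.map_id]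
    exact congrArg AddCommGrpCat.ofHom (BarTensor.map_id (α.act k) m _)
  map_comp f g := by
    simp only [CategoryTheory.Functor.map_comp]
    exact congrArg AddCommGrpCat.ofHom (BarTensor.map_comp _ _ _ _ (α.map_act f) (α.map_act g) _ m)

/-- The differential `B_{m+1}(G_*, A_*) → B_m(G_*, A_*)` given by that of the resolutions
`B_*(G_k)`. -/
noncomputable def barD (m : ℕ) : α.bar (m + 1) ⟶ α.bar m where
  app k := AddCommGrpCat.ofHom (BarTensor.d (α.act k) m)
  naturality _ _ f :=
    congrArg AddCommGrpCat.ofHom (BarTensor.map_d (G.map f).hom (A.map f).hom (α.map_act f) m)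

lemma barD_comp_barD (m : ℕ) : α.barD (m + 1) ≫ α.barD m = 0 := by
  refine NatTrans.ext (funext fun k => ?_)
  exact congrArg AddCommGrpCat.ofHom (BarTensor.d_comp_d (α.act k) m)

/-- The bicomplex `B(G_*, A_*)`, with `B_m(G_k) ⊗_{G_k} A_k` in bidegree `(m, k)`. The differential
in the direction of `m` is that of the resolutions `B_*(G_k)`, and the differential in the direction
of `k` is the alternating sum of the face maps of `B_m(G_*, A_*)`. -/
noncomputable def bicomplex :
    HomologicalComplex₂ AddCommGrpCat.{max u v} (ComplexShape.down ℕ) (ComplexShape.down ℕ) :=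
  ((AlgebraicTopology.alternatingFaceMapComplex AddCommGrpCat.{max u v}).mapHomologicalComplex
    (ComplexShape.down ℕ)).obj (ChainComplex.of α.bar α.barD α.barD_comp_barD)

/-- The homology `H_n(G_*, A_*) = H_n(Tot B(G_*, A_*))`. -/
noncomputable def homology (n : ℕ) : AddCommGrpCat.{max u v} :=
  (α.bicomplex.total (ComplexShape.down ℕ)).homology n

end SimplicialAction

namespace CrossedModule

/-- The action of the nerve of `X` on the nerve of an abelian crossed module `Y` induced by an action
of `X` on `Y`. -/
def Action.nerve {H G : Type u} {M P : Type v} [Group H] [Group G] [Group M] [Group P]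
    {X : CrossedModule H G} {Y : CrossedModule M P} (a : X.Action Y) (hY : Y.IsAbelian) :
    SimplicialAction X.nerve (Y.abelianNerve hY) where
  act n :=
    letI := Nerve.commGroup hY n.unop.len
    show Nerve X n.unop.len →* AddMonoid.End (Additive (Nerve Y n.unop.len)) from
    { toFun := fun x => MonoidHom.toAdditive (a.nerveAct n.unop.len x)
      map_one' := by rw [map_one]; rfl
      map_mul' := fun x x' => by rw [map_mul]; rfl }
  map_act f x y := rfl

/-- The homology `H_n((H, G, μ), (C, A, ν))` of a crossed module with coefficients in an abelian
crossed module on which it acts. -/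
noncomputable def homology {H G : Type u} {C A : Type v} [Group H] [Group G] [Group C] [Group A]
    (X : CrossedModule H G) (Y : CrossedModule C A) (hY : Y.IsAbelian) (a : X.Action Y) (n : ℕ) :
    AddCommGrpCat.{max u v} :=
  (a.nerve hY).homology n

/-- The homology `H_n(H, G, μ)` with integral coefficients: the homology with coefficients in
`(0, ℤ, 0)` with the trivial action. -/
noncomputable def integralHomology {H G : Type u} [Group H] [Group G] (X : CrossedModule H G)
    (n : ℕ) : AddCommGrpCat.{u} :=
  X.homology integers isAbelian_integers (Action.trivial X integers) n

end CrossedModule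

/-! ### Equivariant maps between standard resolutions -/

namespace Bar

variable {G : Type u} [Group G]

/-! A crossed module that is free on a set `S` is the inclusion of the kernel `R` of a split
epimorphism from `F` onto the free group `Q` on `S` (`IsFree.exists_splitting`). An `n`-simplex of
its nerve is therefore a tuple of `n + 1` elements of `F` congruent modulo `R`. Replacing final
entries by the chosen representative of their common class deforms the nerve, through homomorphisms,
onto the constant simplicial group `Q` (`nerveHomotopy`).

The deformation need not be compatible with the action on the coefficients. For fixed `m` this does
no harm: `B_m(G_k) ⊗_{G_k} A_k` is `ℤ[G_k^m] ⊗ A_k`, and in this form the face maps in the direction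
of `k` do not involve the action (`finsuppEquiv_map`). Combined with the normalization of `A_*`, the
deformation reduces the bicomplex, up to boundaries in the direction of `k`, to the subbicomplex
`B_m(Q) ⊗_Q N_k(A_*)` of normalized chains. The homotopies need not commute with the differential in
the direction of `m`, so the passage to total complexes is an induction on `k`
(`exists_total_boundary`), which takes the place of a spectral sequence.

For the nerve of an abelian crossed module only `N_0` and `N_1` can be nonzero, and `N_1` vanishes
too if the top group is trivial (`normalizedChains_abelianNerve`). The rows that remain compute the
homology of the free group `Q`, which vanishes in degrees at least two because the Fox derivative
splits the standard resolution there (`exists_contraction_freeGroup`). The row `k = 1` is shifted by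
one in the total complex. This gives vanishing from degree three on, and from degree two on when
that row is zero. -/

@[simp]
lemma rightMul_single (m : ℕ) (g : G) (x : Fin (m + 1) → G) (c : ℤ) :
    rightMul m g (Finsupp.single x c) =
      Finsupp.single (Fin.cons (g⁻¹ * x 0) (Fin.tail x)) c := by
  simp [rightMul]

lemma rightMul_rightMul (m : ℕ) (g h : G) (b : Bar G m) :
    rightMul m g (rightMul m h b) = rightMul m (h * g) b := by
  have : (rightMul m g).comp (rightMul m h) = rightMul m (h * g) := by
    ext x : 2
    simp [mul_assoc]
  exact DFunLike.congr_fun this b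

@[simp]
lemma rightMul_one (m : ℕ) (b : Bar G m) : rightMul m (1 : G) b = b := by
  have : rightMul m (1 : G) = AddMonoidHom.id _ := by
    ext x : 2
    simp
  exact DFunLike.congr_fun this b

/-- A homomorphism between terms of the standard resolution is equivariant. -/
def IsEquivariant {m n : ℕ} (f : Bar G m →+ Bar G n) : Prop :=
  ∀ g b, f (rightMul m g b) = rightMul n g (f b)

lemma isEquivariant_id (m : ℕ) : IsEquivariant (AddMonoidHom.id (Bar G m)) := fun _ _ => rfl

lemma isEquivariant_d (m : ℕ) : IsEquivariant (d G m) := fun g b =>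
  DFunLike.congr_fun (rightMul_d m g) b

lemma IsEquivariant.comp {m n k : ℕ} {f : Bar G n →+ Bar G k} {f' : Bar G m →+ Bar G n}
    (hf : IsEquivariant f) (hf' : IsEquivariant f') : IsEquivariant (f.comp f') := fun g b => by
  simp [hf' g b, hf g]

lemma IsEquivariant.sub {m n : ℕ} {f f' : Bar G m →+ Bar G n}
    (hf : IsEquivariant f) (hf' : IsEquivariant f') : IsEquivariant (f - f') := fun g b => by
  simp [hf' g b, hf g b]

/-! ### Freeness of the terms of the standard resolution, and its contracting homotopy -/

lemma single_eq_rightMul {m : ℕ} (x : Fin (m + 1) → G) :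
    (Finsupp.single x 1 : Bar G m) =
      rightMul m (x 0)⁻¹ (Finsupp.single (Fin.cons 1 (Fin.tail x)) 1) := by
  simp

lemma IsEquivariant.ext {m n : ℕ} {f f' : Bar G m →+ Bar G n}
    (hf : IsEquivariant f) (hf' : IsEquivariant f')
    (h : ∀ y : Fin m → G, f (Finsupp.single (Fin.cons 1 y) 1) =
      f' (Finsupp.single (Fin.cons 1 y) 1)) : f = f' := by
  ext x : 2
  change f (Finsupp.single x 1) = f' (Finsupp.single x 1)
  rw [single_eq_rightMul, hf, hf', h]

/-- The equivariant homomorphism with prescribed values on the basis `1 ⊗ g₁ ⊗ ⋯ ⊗ g_m`. -/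
noncomputable def extend {m n : ℕ} (w : (Fin m → G) → Bar G n) : Bar G m →+ Bar G n :=
  Finsupp.liftAddHom fun x : Fin (m + 1) → G =>
    (smulAddHom ℤ (Bar G n)).flip (rightMul n (x 0)⁻¹ (w (Fin.tail x)))

@[simp]
lemma extend_single {m n : ℕ} (w : (Fin m → G) → Bar G n) (x : Fin (m + 1) → G) (c : ℤ) :
    extend w (Finsupp.single x c) = c • rightMul n (x 0)⁻¹ (w (Fin.tail x)) := by
  simp [extend]

lemma isEquivariant_extend {m n : ℕ} (w : (Fin m → G) → Bar G n) : IsEquivariant (extend w) := by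
  intro g b
  have : (extend w).comp (rightMul m g) = (rightMul n g).comp (extend w) := by
    ext x : 2
    simp [rightMul_rightMul]
  exact DFunLike.congr_fun this b

/-- The contracting homotopy `g₀ ⊗ ⋯ ⊗ g_m ↦ 1 ⊗ g₀ ⊗ ⋯ ⊗ g_m`. -/
noncomputable def cone (m : ℕ) : Bar G m →+ Bar G (m + 1) :=
  Finsupp.mapDomain.addMonoidHom fun x => (Fin.cons 1 x : Fin (m + 2) → G)

lemma face_zero_cone (m : ℕ) (b : Bar G m) : face G m 0 (cone m b) = b := by
  have : (face G m 0).comp (cone m) = AddMonoidHom.id _ := by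
    ext x : 2
    simp only [face, cone, AddMonoidHom.comp_apply, Finsupp.mapDomain.addMonoidHom_apply,
      Finsupp.singleAddHom_apply, Finsupp.mapDomain_single, AddMonoidHom.id_apply]
    congr 1
    ext k
    refine Fin.cases ?_ (fun k => ?_) k <;> simp [Fin.contractNth]
  exact DFunLike.congr_fun this b

lemma face_succ_cone (m : ℕ) (j : Fin (m + 2)) (b : Bar G (m + 1)) :
    face G (m + 1) j.succ (cone (m + 1) b) = cone m (face G m j b) := by
  have : (face G (m + 1) j.succ).comp (cone (m + 1)) = (cone m).comp (face G m j) := by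
    ext x : 2
    simp only [face, cone, AddMonoidHom.comp_apply, Finsupp.mapDomain.addMonoidHom_apply,
      Finsupp.singleAddHom_apply, Finsupp.mapDomain_single]
    congr 1
    ext k
    refine Fin.cases ?_ (fun k => ?_) k
    · simp [Fin.contractNth]
    · simp [Fin.contractNth]
  exact DFunLike.congr_fun this b

/-- The zeroth face undoes the cone. Every other face passes through it with its index lowered by
one, hence with the opposite sign. -/
lemma d_cone (m : ℕ) (b : Bar G (m + 1)) :
    d G (m + 1) (cone (m + 1) b) = b - cone m (d G m b) := by
  simp only [d, AddMonoidHom.finsetSum_apply, AddMonoidHom.smul_apply, map_sum, map_zsmul]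
  rw [Fin.sum_univ_succ]
  simp [face_zero_cone, face_succ_cone, pow_succ, sub_eq_add_neg]

/-- The source is free over `G` and the target complex is exact. The cone is not equivariant, so it
is used only on the basis of tuples starting with `1` and the result is extended equivariantly. -/
lemma exists_equivariant_lift {m n : ℕ} (f : Bar G m →+ Bar G (n + 1)) (hf : IsEquivariant f)
    (h : ∀ b, d G n (f b) = 0) :
    ∃ t : Bar G m →+ Bar G (n + 2), IsEquivariant t ∧ ∀ b, d G (n + 1) (t b) = f b := by
  refine ⟨extend fun y => cone (n + 1) (f (Finsupp.single (Fin.cons 1 y) 1)),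
    isEquivariant_extend _, fun b => ?_⟩
  refine DFunLike.congr_fun (f := (d G (n + 1)).comp (extend _)) (IsEquivariant.ext
    ((isEquivariant_d _).comp (isEquivariant_extend _)) hf fun y => ?_) b
  simp [d_cone, h]

/-- A contraction of the standard resolution in degree one propagates to all higher degrees. -/
lemma exists_contraction (h : ∃ t : Bar G 1 →+ Bar G 2, IsEquivariant t ∧
    ∀ b, d G 1 (t (d G 1 b)) = d G 1 b) (m : ℕ) :
    ∃ (t : Bar G (m + 1) →+ Bar G (m + 2)) (t' : Bar G (m + 2) →+ Bar G (m + 3)),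
      IsEquivariant t ∧ IsEquivariant t' ∧ ∀ b, d G (m + 2) (t' b) + t (d G (m + 1) b) = b := by
  have key : ∀ (m : ℕ) (t : Bar G (m + 1) →+ Bar G (m + 2)), IsEquivariant t →
      (∀ b, d G (m + 1) (t (d G (m + 1) b)) = d G (m + 1) b) →
      ∃ t' : Bar G (m + 2) →+ Bar G (m + 3), IsEquivariant t' ∧
        ∀ b, d G (m + 2) (t' b) + t (d G (m + 1) b) = b := by
    intro m t ht e
    -- By `e`, the map `1 - t d` takes values in cycles, so it lifts along the next differential.
    obtain ⟨t', ht', e'⟩ := exists_equivariant_lift (AddMonoidHom.id _ - t.comp (d G (m + 1)))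
      ((isEquivariant_id _).sub (ht.comp (isEquivariant_d _))) (fun b => by simp [e])
    exact ⟨t', ht', fun b => by simp [e']⟩
  induction m with
  | zero =>
    obtain ⟨t, ht, e⟩ := h
    obtain ⟨t', ht', e'⟩ := key 0 t ht e
    exact ⟨t, t', ht, ht', e'⟩
  | succ m ih =>
    obtain ⟨t, t', _, ht', e⟩ := ih
    -- On a boundary the term `t d` of the homotopy identity disappears, which leaves the hypothesis
    -- of `key` for `t'`.
    obtain ⟨t'', ht'', e'⟩ := key (m + 1) t' ht' fun b => by
      have := DFunLike.congr_fun (d_comp_d (G := G) (m + 1)) b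
      simp only [AddMonoidHom.comp_apply, AddMonoidHom.zero_apply] at this
      simpa [this] using e (d G (m + 2) b)
    exact ⟨t', t'', ht', ht'', e'⟩

end Bar

/-! ### Acyclicity for free groups -/

namespace Bar

variable {S : Type u}

/-- The action of a free group on `B₁` by affine transformations whose translational part is
the Fox derivative. -/
noncomputable def foxAction : FreeGroup S →* Equiv.Perm (Bar (FreeGroup S) 1) :=
  FreeGroup.lift fun s =>
    { toFun := fun b => rightMul 1 (FreeGroup.of s)⁻¹ b + Finsupp.single ![1, FreeGroup.of s] 1
      invFun := fun b => rightMul 1 (FreeGroup.of s) (b - Finsupp.single ![1, FreeGroup.of s] 1)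
      left_inv := fun b => by simp [rightMul_rightMul]
      right_inv := fun b => by simp [rightMul_rightMul] }

/-- The universal Fox derivative, with `s ↦ 1 ⊗ s` for the free generators `s`. -/
noncomputable def fox (g : FreeGroup S) : Bar (FreeGroup S) 1 := foxAction g 0

/-- Affine maps compose to affine maps and their linear parts multiply, so it suffices to know the
generators and their inverses. Composition of the translational parts then gives the product rule of
Fox calculus. -/
lemma foxAction_apply (g : FreeGroup S) (b : Bar (FreeGroup S) 1) :
    foxAction g b = rightMul 1 g⁻¹ b + fox g := by
  have key : ∀ g h : FreeGroup S, (∀ b, foxAction g b = rightMul 1 g⁻¹ b + fox g) →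
      (∀ b, foxAction h b = rightMul 1 h⁻¹ b + fox h) →
      ∀ b, foxAction (g * h) b = rightMul 1 (g * h)⁻¹ b + fox (g * h) := by
    intro g h hg hh b
    simp only [fox, map_mul, Equiv.Perm.mul_apply]
    rw [hh, hg, hg, map_add, rightMul_rightMul, mul_inv_rev, ← fox, add_assoc]
  revert b
  induction g using FreeGroup.induction_on with
  | C1 => intro b; simp [fox]
  | of s => intro b; simp [fox, foxAction]
  | inv_of s h =>
    have h₀ := h (fox (FreeGroup.of s)⁻¹)
    rw [fox, ← Equiv.Perm.mul_apply, ← map_mul, mul_inv_cancel, map_one, Equiv.Perm.one_apply,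
      ← fox] at h₀
    intro b
    apply (foxAction (FreeGroup.of s)).injective
    rw [← Equiv.Perm.mul_apply, ← map_mul, mul_inv_cancel, map_one, Equiv.Perm.one_apply, h,
      map_add, add_assoc, ← h₀, rightMul_rightMul]
    simp
  | mul g h hg hh => exact key g h hg hh

lemma fox_mul (g h : FreeGroup S) : fox (g * h) = rightMul 1 g⁻¹ (fox h) + fox g := by
  rw [← foxAction_apply, fox, map_mul, Equiv.Perm.mul_apply, ← fox]

lemma fox_one : fox (1 : FreeGroup S) = 0 := by simp [fox]

lemma fox_of (s : S) : fox (FreeGroup.of s) = Finsupp.single ![1, FreeGroup.of s] 1 := by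
  simp [fox, foxAction]

lemma d_single_pair {G : Type u} [Group G] (g h : G) :
    d G 0 (Finsupp.single ![g, h] 1) =
      Finsupp.single ![g * h] 1 - Finsupp.single ![g] 1 := by
  simp only [d, AddMonoidHom.finsetSum_apply, AddMonoidHom.smul_apply, face,
    Finsupp.mapDomain.addMonoidHom_apply, Finsupp.mapDomain_single]
  rw [Fin.sum_univ_two]
  simp only [Fin.val_zero, pow_zero, one_smul, Fin.val_one, pow_one, neg_smul, ← sub_eq_add_neg]
  congr 2 <;> ext k <;> fin_cases k <;> simp [Fin.contractNth]

/-- Both sides obey the same product rule and agree on the free generators. -/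
lemma d_fox (g : FreeGroup S) :
    d (FreeGroup S) 0 (fox g) = Finsupp.single ![g] 1 - Finsupp.single ![1] 1 := by
  have hr : ∀ g h : FreeGroup S, rightMul 0 g (Finsupp.single ![h] 1) =
      Finsupp.single ![g⁻¹ * h] 1 := fun g h => by
    rw [rightMul_single]; congr 1
  induction g using FreeGroup.induction_on with
  | C1 => simp [fox_one]
  | of s => rw [fox_of, d_single_pair, one_mul]
  | inv_of s h =>
    have : fox (FreeGroup.of s)⁻¹ = - rightMul 1 (FreeGroup.of s) (fox (FreeGroup.of s)) := by
      have := fox_mul (FreeGroup.of s)⁻¹ (FreeGroup.of s)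
      rw [inv_mul_cancel, fox_one, inv_inv] at this
      exact (neg_eq_of_add_eq_zero_right this.symm).symm
    rw [this, map_neg, isEquivariant_d, h, map_sub, hr, hr]
    simp
  | mul g h hg hh =>
    rw [fox_mul, map_add, isEquivariant_d, hg, hh, map_sub, hr, hr]
    simp

lemma d_single_triple {G : Type u} [Group G] (g h : G) :
    d G 1 (Finsupp.single ![1, g, h] 1) = Finsupp.single ![g, h] 1 -
      Finsupp.single ![1, g * h] 1 + Finsupp.single ![1, g] 1 := by
  simp only [d, AddMonoidHom.finsetSum_apply, AddMonoidHom.smul_apply, face,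
    Finsupp.mapDomain.addMonoidHom_apply, Finsupp.mapDomain_single]
  rw [Fin.sum_univ_three]
  simp only [Fin.val_zero, pow_zero, one_smul, Fin.val_one, pow_one, neg_smul, ← sub_eq_add_neg,
    Fin.val_two, even_two, Even.neg_pow, one_pow]
  congr 3 <;> ext k <;> fin_cases k <;> simp [Fin.contractNth]

/-- Extending the Fox derivative equivariantly gives an endomorphism `T` of `B₁` with `d T = d` and
`T d = 0`. By the first identity `1 - T` has values in cycles, hence equals `d t` for an equivariant
`t`; by the second, `d t d = d - T d = d`. -/
lemma exists_contraction_freeGroup (S : Type u) :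
    ∃ t : Bar (FreeGroup S) 1 →+ Bar (FreeGroup S) 2, IsEquivariant t ∧
      ∀ b, d (FreeGroup S) 1 (t (d (FreeGroup S) 1 b)) = d (FreeGroup S) 1 b := by
  let T : Bar (FreeGroup S) 1 →+ Bar (FreeGroup S) 1 := extend fun y => fox (y 0)
  have hT : IsEquivariant T := isEquivariant_extend _
  have hd : (d (FreeGroup S) 0).comp T = d (FreeGroup S) 0 := by
    refine IsEquivariant.ext ((isEquivariant_d _).comp hT) (isEquivariant_d _) fun y => ?_
    have : (Fin.cons 1 y : Fin 2 → FreeGroup S) = ![1, y 0] := by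
      ext k; fin_cases k <;> simp
    rw [this, d_single_pair]
    simp [T, d_fox, Fin.tail]
  have hTd : T.comp (d (FreeGroup S) 1) = 0 := by
    refine IsEquivariant.ext (hT.comp (isEquivariant_d _)) (fun _ _ => by simp) fun y => ?_
    have : (Fin.cons 1 y : Fin 3 → FreeGroup S) = ![1, y 0, y 1] := by
      ext k; fin_cases k <;> rfl
    rw [this, AddMonoidHom.comp_apply, d_single_triple]
    -- The three terms of the differential of `1 ⊗ g ⊗ h` become the product rule for `g * h`.
    simp [T, fox_mul, Fin.tail]
  obtain ⟨t, ht, e⟩ := exists_equivariant_lift (AddMonoidHom.id _ - T)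
    ((isEquivariant_id _).sub hT) (fun b => by
      have := DFunLike.congr_fun hd b
      simp only [AddMonoidHom.comp_apply] at this
      simp [this])
  refine ⟨t, ht, fun b => ?_⟩
  have := DFunLike.congr_fun hTd b
  simp only [AddMonoidHom.comp_apply, AddMonoidHom.zero_apply] at this
  simp [e, this]

end Bar

namespace BarTensor

/-- The homology of a free group with arbitrary coefficients vanishes in degrees at least two. -/
lemma exists_d_eq_of_freeGroup {S : Type u} {A : Type v} [AddCommGroup A]
    (φ : FreeGroup S →* AddMonoid.End A) (m : ℕ) (x : BarTensor φ (m + 2))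
    (hx : BarTensor.d φ (m + 1) x = 0) : ∃ y, BarTensor.d φ (m + 2) y = x := by
  obtain ⟨t, t', ht, ht', e⟩ := Bar.exists_contraction (Bar.exists_contraction_freeGroup S) m
  -- Being equivariant, the contraction survives tensoring over the group with any coefficients.
  have key : (d φ (m + 2)).comp (lift (φ' := φ) (MonoidHom.id _) t' (AddMonoidHom.id A) (fun g b => ht' g b)
      (fun _ _ => rfl)) + (lift (φ' := φ) (MonoidHom.id _) t (AddMonoidHom.id A)
      (fun g b => ht g b) (fun _ _ => rfl)).comp (d φ (m + 1)) = AddMonoidHom.id _ := by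
    refine hom_ext fun b a => ?_
    change QuotientAddGroup.mk (Bar.d _ (m + 2) (t' b) ⊗ₜ[ℤ] a) +
      QuotientAddGroup.mk (t (Bar.d _ (m + 1) b) ⊗ₜ[ℤ] a) = QuotientAddGroup.mk (b ⊗ₜ[ℤ] a)
    rw [← QuotientAddGroup.mk_add, ← TensorProduct.add_tmul, e]
  exact ⟨_, by simpa [hx] using DFunLike.congr_fun key x⟩

end BarTensor

/-! ### Normal forms in `B_m(G) ⊗_G A` -/

/-- The homomorphism `ℤ[X] ⊗ A → ℤ[X'] ⊗ A'` induced by a map and a homomorphism. -/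
noncomputable def Finsupp.bimap {X X' A A' : Type*} [AddCommGroup A] [AddCommGroup A']
    (f : X → X') (k : A →+ A') : (X →₀ A) →+ (X' →₀ A') :=
  Finsupp.liftAddHom fun x => (Finsupp.singleAddHom (f x)).comp k

namespace Finsupp

variable {X X' X'' A A' A'' : Type*} [AddCommGroup A] [AddCommGroup A'] [AddCommGroup A'']

@[simp]
lemma bimap_single (f : X → X') (k : A →+ A') (x : X) (a : A) :
    bimap f k (single x a) = single (f x) (k a) := by
  simp [bimap]

lemma bimap_id : bimap (id : X → X) (AddMonoidHom.id A) = AddMonoidHom.id _ := by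
  ext; simp

lemma bimap_comp (f : X → X') (f' : X' → X'') (k : A →+ A') (k' : A' →+ A'') :
    bimap (f' ∘ f) (k'.comp k) = (bimap f' k').comp (bimap f k) := by
  refine Finsupp.addHom_ext fun x a => ?_
  simp

lemma bimap_bimap (f : X → X') (f' : X' → X'') (k : A →+ A') (k' : A' →+ A'') (z : X →₀ A) :
    bimap f' k' (bimap f k z) = bimap (f' ∘ f) (k'.comp k) z :=
  (DFunLike.congr_fun (bimap_comp f f' k k') z).symm

lemma bimap_injective {f : X → X'} {k : A →+ A'} (hf : Function.Injective f)
    (hk : Function.Injective k) : Function.Injective (bimap f k) := by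
  have : ∀ z, bimap f k z = mapDomain f (mapRange k k.map_zero z) := fun z =>
    DFunLike.congr_fun (g := (mapDomain.addMonoidHom f).comp (mapRange.addMonoidHom k))
      (Finsupp.addHom_ext fun x a => by simp) z
  intro z z' h
  rw [this, this] at h
  exact mapRange_injective k k.map_zero hk (mapDomain_injective hf h)

lemma bimap_id_apply (k : A →+ A') (z : X →₀ A) (x : X) : bimap id k z x = k (z x) := by
  have : (applyAddHom x).comp (bimap id k) = k.comp (applyAddHom x) := by
    refine Finsupp.addHom_ext fun y a => ?_
    classical
    simp only [AddMonoidHom.comp_apply, bimap_single, id, applyAddHom_apply, single_apply]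
    split_ifs <;> simp
  exact DFunLike.congr_fun this z

end Finsupp

namespace BarTensor

variable {G : Type u} [Group G] {A : Type v} [AddCommGroup A] (φ : G →* AddMonoid.End A) (m : ℕ)

/-- The homomorphism `g₀ ⊗ ⋯ ⊗ g_m ⊗ a ↦ (g₁, …, g_m) ⊗ g₀⁻¹ a`. -/
noncomputable def toFinsupp : BarTensor φ m →+ ((Fin m → G) →₀ A) :=
  QuotientAddGroup.lift _ (TensorProduct.liftAddHom
    (Finsupp.liftAddHom fun x : Fin (m + 1) → G => (smulAddHom ℤ _).flip
      ((Finsupp.singleAddHom (Fin.tail x)).comp (φ (x 0)⁻¹)))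
    (fun r b a => by rw [map_zsmul, map_zsmul]; rfl)) <| by
    rw [barTensorRel, AddSubgroup.closure_le]
    rintro _ ⟨b, g, a, rfl⟩
    simp only [SetLike.mem_coe, AddMonoidHom.mem_ker, map_sub, TensorProduct.liftAddHom_tmul]
    rw [sub_eq_zero]
    refine DFunLike.congr_fun (f := ((AddMonoidHom.eval a).comp ((Finsupp.liftAddHom _))).comp
      (Bar.rightMul m g)) (g := (AddMonoidHom.eval (φ g a)).comp ((Finsupp.liftAddHom _)))
        (AddMonoidHom.ext fun b => ?_) b
    induction b using Finsupp.induction_linear with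
    | zero => simp
    | add f g hf hg => simp only [map_add, hf, hg]
    | single x c => simp; rfl

@[simp]
lemma toFinsupp_mk_single (x : Fin (m + 1) → G) (a : A) :
    toFinsupp φ m (QuotientAddGroup.mk (Finsupp.single x 1 ⊗ₜ[ℤ] a)) =
      Finsupp.single (Fin.tail x) (φ (x 0)⁻¹ a) := by
  change Finsupp.liftAddHom (fun x : Fin (m + 1) → G => (smulAddHom ℤ _).flip
    ((Finsupp.singleAddHom (Fin.tail x)).comp (φ (x 0)⁻¹))) (Finsupp.single x 1) a = _
  simp
  rfl

/-- The homomorphism `(g₁, …, g_m) ⊗ a ↦ 1 ⊗ g₁ ⊗ ⋯ ⊗ g_m ⊗ a`. -/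
noncomputable def ofFinsupp : ((Fin m → G) →₀ A) →+ BarTensor φ m :=
  Finsupp.liftAddHom fun y => (QuotientAddGroup.mk' _).comp
    (TensorProduct.mk ℤ (Bar G m) A (Finsupp.single (Fin.cons 1 y) 1)).toAddMonoidHom

@[simp]
lemma ofFinsupp_single (y : Fin m → G) (a : A) :
    ofFinsupp φ m (Finsupp.single y a) =
      QuotientAddGroup.mk (Finsupp.single (Fin.cons 1 y) 1 ⊗ₜ[ℤ] a) := by
  simp [ofFinsupp]

variable {φ m} in
lemma hom_ext_single {B : Type*} [AddCommGroup B] {f f' : BarTensor φ m →+ B}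
    (h : ∀ (x : Fin (m + 1) → G) (a : A),
      f (QuotientAddGroup.mk (Finsupp.single x 1 ⊗ₜ[ℤ] a)) =
        f' (QuotientAddGroup.mk (Finsupp.single x 1 ⊗ₜ[ℤ] a))) : f = f' := by
  refine hom_ext fun b a => ?_
  induction b using Finsupp.induction_linear with
  | zero => simp
  | add b b' hb hb' => simp only [TensorProduct.add_tmul, QuotientAddGroup.mk_add, map_add, hb, hb']
  | single x c =>
    have : (Finsupp.single x c : Bar G m) = c • Finsupp.single x 1 := by simp
    rw [this, TensorProduct.smul_tmul, h]

/-- `B_m(G) ⊗_G A` is isomorphic to `ℤ[G^m] ⊗ A`. -/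
noncomputable def finsuppEquiv : BarTensor φ m ≃+ ((Fin m → G) →₀ A) :=
  (toFinsupp φ m).toAddEquiv (ofFinsupp φ m)
    (hom_ext_single fun x a => by
      simp only [AddMonoidHom.comp_apply, toFinsupp_mk_single, ofFinsupp_single,
        AddMonoidHom.id_apply]
      rw [Bar.single_eq_rightMul x, eq_comm, ← sub_eq_zero, ← QuotientAddGroup.mk_sub,
        QuotientAddGroup.eq_zero_iff]
      exact AddSubgroup.subset_closure ⟨_, _, _, rfl⟩)
    (Finsupp.addHom_ext fun y a => by
      simp)

variable {φ m}

@[simp]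
lemma finsuppEquiv_mk_single (x : Fin (m + 1) → G) (a : A) :
    finsuppEquiv φ m (QuotientAddGroup.mk (Finsupp.single x 1 ⊗ₜ[ℤ] a)) =
      Finsupp.single (Fin.tail x) (φ (x 0)⁻¹ a) :=
  toFinsupp_mk_single φ m x a

/-- In normal form the induced maps depend only on `f` and `k`, not on the actions. This is what
allows the simplicial group to be deformed while the coefficients stay fixed. -/
lemma finsuppEquiv_map {G' : Type u} [Group G'] {A' : Type v} [AddCommGroup A']
    {φ' : G' →* AddMonoid.End A'} (f : G →* G') (k : A →+ A')
    (hk : ∀ g a, k (φ g a) = φ' (f g) (k a)) (t : BarTensor φ m) :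
    finsuppEquiv φ' m (map f k hk m t) =
      Finsupp.bimap (fun y => f ∘ y) k (finsuppEquiv φ m t) := by
  refine DFunLike.congr_fun (f := (finsuppEquiv φ' m).toAddMonoidHom.comp (map f k hk m))
    (g := (Finsupp.bimap (fun y => f ∘ y) k).comp (finsuppEquiv φ m).toAddMonoidHom)
    (hom_ext_single fun x a => ?_) t
  have : Bar.map f m (Finsupp.single x 1) = Finsupp.single (f ∘ x) 1 := by simp [Bar.map]
  simp only [AddMonoidHom.comp_apply, map_mk, this]
  change finsuppEquiv φ' m _ = Finsupp.bimap _ k (finsuppEquiv φ m _)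
  rw [finsuppEquiv_mk_single, finsuppEquiv_mk_single, Finsupp.bimap_single, hk, _root_.map_inv f]
  rfl

end BarTensor

/-! ### Total complexes of bicomplexes of abelian groups -/

/-- A total cycle of a bicomplex is a boundary if, up to vertical boundaries, the bicomplex
reduces to a subbicomplex with two nonzero rows which are horizontally exact where it matters. -/
lemma exists_total_boundary {D : ℕ → ℕ → Type*} [∀ m k, AddCommGroup (D m k)]
    (dh : ∀ m k, D (m + 1) k →+ D m k) (dv : ∀ m k, D m (k + 1) →+ D m k)
    (hh : ∀ m k x, dh m k (dh (m + 1) k x) = 0) (vv : ∀ m k x, dv m k (dv m (k + 1) x) = 0)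
    (hv : ∀ m k x, dh m k (dv (m + 1) k x) + dv m k (dh m (k + 1) x) = 0)
    (S : ∀ m k, AddSubgroup (D m k)) (Sh : ∀ m k, ∀ x ∈ S (m + 1) k, dh m k x ∈ S m k)
    (Sv : ∀ m k, ∀ x ∈ S m (k + 1), dv m k x ∈ S m k)
    (c₀ : ∀ m (x : D m 0), ∃ y, x - dv m 0 y ∈ S m 0)
    (c₁ : ∀ m k (x : D m (k + 1)), dv m k x ∈ S m k → ∃ y, x - dv m (k + 1) y ∈ S m (k + 1))
    (z : ∀ m k, ∀ x ∈ S m (k + 2), x = 0) (n : ℕ)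
    (r₀ : ∀ x ∈ S (n + 2) 0, dh (n + 1) 0 x = 0 → ∃ y ∈ S (n + 3) 0, dh (n + 2) 0 y = x)
    (r₁ : ∀ x ∈ S (n + 1) 1, dh n 1 x = 0 → ∃ y ∈ S (n + 2) 1, dh (n + 1) 1 y = x)
    (x : ∀ m k, D m k)
    (hx : ∀ m k, m + k = n + 1 → dh m k (x (m + 1) k) + dv m k (x m (k + 1)) = 0) :
    ∃ y : ∀ m k, D m k,
      ∀ m k, m + k = n + 2 → dh m k (y (m + 1) k) + dv m k (y m (k + 1)) = x m k := by
  classical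
  -- Extension by zero off the relevant antidiagonal makes the cycle equation hold in every
  -- bidegree.
  let x' : ∀ m k, D m k := fun m k => if m + k = n + 2 then x m k else 0
  have hx' : ∀ m k, dh m k (x' (m + 1) k) + dv m k (x' m (k + 1)) = 0 := by
    intro m k
    by_cases h : m + k = n + 1
    · have h₁ : m + 1 + k = n + 2 := by omega
      have h₂ : m + (k + 1) = n + 2 := by omega
      simp only [x', if_pos h₁, if_pos h₂, hx m k h]
    · have h₁ : ¬ m + 1 + k = n + 2 := by omega
      have h₂ : ¬ m + (k + 1) = n + 2 := by omega
      simp only [x', if_neg h₁, if_neg h₂, map_zero, add_zero]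
  -- `c₀` and `c₁` in one statement, so that a single choice function serves the recursion; for `k =
  -- 0` the condition is vacuous.
  have c : ∀ k m (x : D m k), (∀ l (h : k = l + 1), dv m l (h ▸ x) ∈ S m l) →
      ∃ y, x - dv m k y ∈ S m k := by
    intro k m x h
    cases k with
    | zero => exact c₀ m x
    | succ k => exact c₁ m k x (h k rfl)
  choose! g hg using c
  -- Going up in `k`, the next component is chosen so that what is left of `x'` in row `k` lies in
  -- `S`.
  let y : ∀ k m, D m k := fun k => Nat.rec (motive := fun k => ∀ m, D m k) (fun _ => 0)
    (fun k y m => g k m (x' m k - dh m k (y (m + 1)))) k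
  have hy : ∀ k m, y (k + 1) m = g k m (x' m k - dh m k (y k (m + 1))) := fun _ _ => rfl
  have key : ∀ k m, x' m k - dh m k (y k (m + 1)) - dv m k (y (k + 1) m) ∈ S m k := by
    intro k
    induction k with
    | zero =>
      intro m
      rw [hy]
      exact hg 0 m _ (fun l h => by omega)
    | succ k ih =>
      intro m
      rw [hy (k + 1)]
      refine hg (k + 1) m _ fun l h => ?_
      obtain rfl : k = l := by omega
      -- By the cycle equation and anticommutativity, the vertical boundary of the element to be
      -- corrected is minus the horizontal boundary of the remainder one row below, which lies in
      -- `S` by induction.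
      have h₁ := Sh m k _ (ih (m + 1))
      rw [map_sub, map_sub, hh, sub_zero] at h₁
      have h₂ := hv m k (y (k + 1) (m + 1))
      have h₃ := hx' m k
      change dv m k (x' m (k + 1) - dh m (k + 1) (y (k + 1) (m + 1))) ∈ S m k
      rw [map_sub]
      convert (S m k).neg_mem h₁ using 1
      rw [add_comm] at h₂ h₃
      rw [eq_neg_of_add_eq_zero_left h₂, eq_neg_of_add_eq_zero_left h₃]
      abel
  let w : ∀ m k, D m k := fun m k => x' m k - dh m k (y k (m + 1)) - dv m k (y (k + 1) m)
  have hw : ∀ m k, dh m k (w (m + 1) k) + dv m k (w m (k + 1)) = 0 := by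
    intro m k
    have h₂ := hv m k (y (k + 1) (m + 1))
    have h₃ := hx' m k
    simp only [w, map_sub, hh, vv, sub_zero]
    rw [sub_add_sub_comm, h₃, h₂, sub_zero]
  have w₂ : ∀ m k, w m (k + 2) = 0 := fun m k => z m k _ (key (k + 2) m)
  -- The remainder `w` is a total cycle supported in rows 0 and 1. Its row 1 part is a horizontal
  -- cycle because row 2 is zero; once it is bounded by `y₁`, subtracting `dv y₁` makes the row 0
  -- part a horizontal cycle as well.
  obtain ⟨y₁, hy₁, e₁⟩ := r₁ (w (n + 1) 1) (key 1 (n + 1)) (by simpa [w₂] using hw n 1)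
  obtain ⟨y₀, hy₀, e₀⟩ := r₀ (w (n + 2) 0 - dv (n + 2) 0 y₁)
    ((S _ _).sub_mem (key 0 (n + 2)) (Sv _ _ _ hy₁)) (by
      have h₁ := hv (n + 1) 0 y₁
      have h₂ := hw (n + 1) 0
      rw [e₁] at h₁
      rw [map_sub, eq_neg_of_add_eq_zero_left h₁, eq_neg_of_add_eq_zero_left h₂]
      exact sub_self _)
  refine ⟨fun m k => y k m + (Pi.single (M := fun m => ∀ k, D m k) (n + 2) (Pi.single 1 y₁) m k +
    Pi.single (M := fun m => ∀ k, D m k) (n + 3) (Pi.single 0 y₀) m k), fun m k h => ?_⟩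
  have hwx : x m k = w m k + (dh m k (y k (m + 1)) + dv m k (y (k + 1) m)) := by
    simp only [w, x', if_pos h]
    abel
  suffices dh m k (Pi.single (M := fun m => ∀ k, D m k) (n + 2) (Pi.single 1 y₁) (m + 1) k +
      Pi.single (M := fun m => ∀ k, D m k) (n + 3) (Pi.single 0 y₀) (m + 1) k) +
      dv m k (Pi.single (M := fun m => ∀ k, D m k) (n + 2) (Pi.single 1 y₁) m (k + 1) +
      Pi.single (M := fun m => ∀ k, D m k) (n + 3) (Pi.single 0 y₀) m (k + 1)) = w m k by
    rw [hwx, ← this]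
    simp only [map_add]
    abel
  match k, h with
  | 0, h =>
    obtain rfl : m = n + 2 := by omega
    simp [e₀]
  | 1, h =>
    obtain rfl : m = n + 1 := by omega
    simp [e₁]
  | k + 2, h =>
    rw [w₂]
    have h₂ : m ≠ n + 3 := by omega
    have h₃ : m ≠ n + 2 := by omega
    have h₄ : m ≠ n + 1 := by omega
    simp [h₂, h₃, h₄]

lemma AddCommGrpCat.hom_sum_apply {M N : AddCommGrpCat.{u}} {ι : Type*} (s : Finset ι)
    (f : ι → (M ⟶ N)) (x : M) : (∑ i ∈ s, f i).hom x = ∑ i ∈ s, (f i).hom x := by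
  classical
  induction s using Finset.induction_on with
  | empty => rfl
  | insert a s ha ih =>
    rw [Finset.sum_insert ha, Finset.sum_insert ha, AddCommGrpCat.hom_add,
      AddMonoidHom.add_apply, ih]

namespace HomologicalComplex₂

variable (K : HomologicalComplex₂ AddCommGrpCat.{u} (ComplexShape.down ℕ) (ComplexShape.down ℕ))

/-- The projection of the total complex onto one of its summands. -/
noncomputable def πTotal (N m k : ℕ) : (K.total (ComplexShape.down ℕ)).X N ⟶ (K.X m).X k :=
  K.totalDesc fun i j _ => if h : i = m ∧ j = k then
    eqToHom (by rw [h.1, h.2]) else 0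

lemma ι_πTotal_self (N m k : ℕ) (h) :
    K.ιTotal (ComplexShape.down ℕ) m k N h ≫ K.πTotal N m k = 𝟙 _ := by
  simp [πTotal]

lemma ι_πTotal_of_ne (N i j m k : ℕ) (h) (hne : ¬ (i = m ∧ j = k)) :
    K.ιTotal (ComplexShape.down ℕ) i j N h ≫ K.πTotal N m k = 0 := by
  simp [πTotal, hne]

lemma sum_πTotal_ι (N : ℕ) :
    ∑ p : Finset.HasAntidiagonal.antidiagonal N, K.πTotal N p.1.1 p.1.2 ≫
      K.ιTotal (ComplexShape.down ℕ) p.1.1 p.1.2 N (Finset.HasAntidiagonal.mem_antidiagonal.mp p.2) = 𝟙 _ := by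
  refine total.hom_ext _ fun i j hij => ?_
  rw [Preadditive.comp_sum, Finset.sum_eq_single ⟨(i, j), Finset.HasAntidiagonal.mem_antidiagonal.mpr hij⟩]
  · rw [← Category.assoc, ι_πTotal_self, Category.id_comp, Category.comp_id]
  · rintro ⟨⟨a, b⟩, hab⟩ _ hne
    rw [← Category.assoc, ι_πTotal_of_ne, zero_comp]
    rintro ⟨rfl, rfl⟩
    exact hne rfl
  · simp

/-- The total differential in coordinates, with the sign `(-1)^m` on its vertical part; checked on
each summand. -/
lemma d_πTotal (N m k : ℕ) (h : m + k = N) :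
    (K.total (ComplexShape.down ℕ)).d (N + 1) N ≫ K.πTotal N m k =
      K.πTotal (N + 1) (m + 1) k ≫ (K.d (m + 1) m).f k +
        (-1 : ℤ) ^ m • K.πTotal (N + 1) m (k + 1) ≫ (K.X m).d (k + 1) k := by
  subst h
  refine total.hom_ext _ fun i j hij => ?_
  rw [total_d, Preadditive.add_comp, Preadditive.comp_add, ← Category.assoc, ← Category.assoc,
    ι_D₁, ι_D₂, Preadditive.comp_add, Preadditive.comp_zsmul, ← Category.assoc, ← Category.assoc]
  have hij : i + j = m + k + 1 := hij
  congr 1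
  · by_cases h : i = m + 1 ∧ j = k
    · obtain ⟨rfl, rfl⟩ := h
      rw [ι_πTotal_self, d₁_eq (i₁' := m) _ _ (by simp) _ _ (show m + j = m + j from rfl)]
      simp [ι_πTotal_self]
    · rw [ι_πTotal_of_ne _ _ _ _ _ _ _ h, zero_comp]
      cases i with
      | zero => rw [d₁_eq_zero _ _ _ _ _ (by simp), zero_comp]
      | succ i =>
        rw [d₁_eq (i₁' := i) _ _ (by simp) _ _ (show i + j = m + k by omega)]
        simp only [Linear.units_smul_comp, Category.assoc]
        rw [ι_πTotal_of_ne _ _ _ _ _ _ _ (by simpa using h), comp_zero, smul_zero]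
  · by_cases h : i = m ∧ j = k + 1
    · obtain ⟨rfl, rfl⟩ := h
      rw [ι_πTotal_self, d₂_eq (i₂' := k) _ _ _ (by simp) _ (show i + k = i + k from rfl)]
      simp [ι_πTotal_self, Units.smul_def]
    · rw [ι_πTotal_of_ne _ _ _ _ _ _ _ h, zero_comp, smul_zero]
      cases j with
      | zero => rw [d₂_eq_zero _ _ _ _ _ (by simp), zero_comp]
      | succ j =>
        rw [d₂_eq (i₂' := j) _ _ _ (by simp) _ (show i + j = m + k by omega)]
        simp only [Linear.units_smul_comp, Category.assoc]
        rw [ι_πTotal_of_ne _ _ _ _ _ _ _ (by simpa using h), comp_zero, smul_zero]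

/-- Acyclicity of the total complex in terms of families of elements of the bicomplex. -/
lemma isZero_homology_total (n : ℕ)
    (H : ∀ x : ∀ m k, (K.X m).X k,
      (∀ m k, m + k = n → ((K.d (m + 1) m).f k).hom (x (m + 1) k) +
        (-1 : ℤ) ^ m • ((K.X m).d (k + 1) k).hom (x m (k + 1)) = 0) →
      ∃ y : ∀ m k, (K.X m).X k, ∀ m k, m + k = n + 1 →
        ((K.d (m + 1) m).f k).hom (y (m + 1) k) +
          (-1 : ℤ) ^ m • ((K.X m).d (k + 1) k).hom (y m (k + 1)) = x m k) :
    IsZero ((K.total (ComplexShape.down ℕ)).homology (n + 1)) := by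
  rw [← HomologicalComplex.exactAt_iff_isZero_homology,
    HomologicalComplex.exactAt_iff' _ (n + 2) (n + 1) n (by simp) (by simp),
    ShortComplex.ab_exact_iff]
  intro t ht
  have hd : ∀ (N : ℕ) (s : (K.total (ComplexShape.down ℕ)).X (N + 1)) (m k : ℕ), m + k = N →
      (K.πTotal N m k).hom (((K.total (ComplexShape.down ℕ)).d (N + 1) N).hom s) =
        ((K.d (m + 1) m).f k).hom ((K.πTotal (N + 1) (m + 1) k).hom s) +
          (-1 : ℤ) ^ m • ((K.X m).d (k + 1) k).hom ((K.πTotal (N + 1) m (k + 1)).hom s) :=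
    fun N s m k h => ConcreteCategory.congr_hom (K.d_πTotal N m k h) s
  obtain ⟨y, hy⟩ := H (fun m k => (K.πTotal (n + 1) m k).hom t) (fun m k h => by
    rw [← hd n t m k h]
    exact (congrArg _ ht).trans (map_zero _))
  let s : (K.total (ComplexShape.down ℕ)).X (n + 2) :=
    ∑ p : Finset.HasAntidiagonal.antidiagonal (n + 2),
      (K.ιTotal (ComplexShape.down ℕ) p.1.1 p.1.2 (n + 2)
        (Finset.HasAntidiagonal.mem_antidiagonal.mp p.2)).hom (y p.1.1 p.1.2)
  have hs : ∀ m k, m + k = n + 2 → (K.πTotal (n + 2) m k).hom s = y m k := by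
    intro m k h
    simp only [s, map_sum]
    rw [Finset.sum_eq_single ⟨(m, k), Finset.HasAntidiagonal.mem_antidiagonal.mpr h⟩]
    · exact ConcreteCategory.congr_hom (K.ι_πTotal_self (n + 2) m k h) (y m k)
    · rintro ⟨⟨a, b⟩, hab⟩ _ hne
      refine ConcreteCategory.congr_hom (K.ι_πTotal_of_ne (n + 2) a b m k _ ?_) (y a b)
      rintro ⟨rfl, rfl⟩
      exact hne rfl
    · simp
  refine ⟨s, ?_⟩
  -- The antidiagonal is finite, so an element of the total complex is determined by its
  -- projections.
  have hext : ∀ t' : (K.total (ComplexShape.down ℕ)).X (n + 1),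
      (∀ m k, m + k = n + 1 → (K.πTotal (n + 1) m k).hom t' = (K.πTotal (n + 1) m k).hom t) →
      t' = t := by
    intro t' h
    have e := fun t => ConcreteCategory.congr_hom (K.sum_πTotal_ι (n + 1)) t
    have e' : ∀ t : (K.total (ComplexShape.down ℕ)).X (n + 1),
        ∑ p : Finset.HasAntidiagonal.antidiagonal (n + 1),
        (K.ιTotal (ComplexShape.down ℕ) p.1.1 p.1.2 (n + 1)
        (Finset.HasAntidiagonal.mem_antidiagonal.mp p.2)).hom
          ((K.πTotal (n + 1) p.1.1 p.1.2).hom t) = t := by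
      intro t
      exact (AddCommGrpCat.hom_sum_apply _ _ _).symm.trans (e t)
    rw [← e' t', ← e' t]
    refine Finset.sum_congr rfl fun p _ => ?_
    rw [h _ _ (Finset.HasAntidiagonal.mem_antidiagonal.mp p.2)]
  refine hext _ fun m k h => ?_
  rw [← hy m k h]
  refine (hd (n + 1) s m k h).trans ?_
  rw [hs _ _ (by omega), hs _ _ (by omega)]

end HomologicalComplex₂

/-! ### Homotopies -/

open AlgebraicTopology Simplicial Opposite

/-- If an idempotent endomorphism of a complex of abelian groups is homotopic to the identity,
then every chain whose boundary is fixed is homologous to a fixed chain, additively. -/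
lemma exists_add_hom_of_homotopy {K : ChainComplex AddCommGrpCat.{u} ℕ} (e : K ⟶ K)
    (he : e ≫ e = e) (h : Homotopy e (𝟙 K)) (k : ℕ) :
    ∃ g : K.X (k + 1) →+ K.X (k + 2), ∀ x, (e.f k).hom ((K.d (k + 1) k).hom x) =
      (K.d (k + 1) k).hom x → x - (K.d (k + 2) (k + 1)).hom (g x) = (e.f (k + 1)).hom x := by
  have comm : ∀ x, (e.f (k + 1)).hom x = (h.hom k (k + 1)).hom ((K.d (k + 1) k).hom x) +
      (K.d (k + 2) (k + 1)).hom ((h.hom (k + 1) (k + 2)).hom x) + x := fun x => by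
    have := h.comm (k + 1)
    rw [dNext_eq (i' := k) (w := by simp), prevD_eq (j' := k + 2) (w := by simp)] at this
    exact ConcreteCategory.congr_hom this x
  have hee : ∀ x, (e.f (k + 1)).hom ((e.f (k + 1)).hom x) = (e.f (k + 1)).hom x := fun x =>
    ConcreteCategory.congr_hom (HomologicalComplex.congr_hom he (k + 1)) x
  have hd : ∀ x, (K.d (k + 1) k).hom ((e.f (k + 1)).hom x) =
      (e.f k).hom ((K.d (k + 1) k).hom x) := fun x =>
    ConcreteCategory.congr_hom (e.comm (k + 1) k) x
  -- For `x` with fixed boundary, `e x - x` is a cycle killed by `e`, so the homotopy `h` exhibits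
  -- it as a boundary. The witness is additive in `x`, which later allows it to be applied
  -- coefficientwise.
  refine ⟨((h.hom (k + 1) (k + 2)).hom).comp ((e.f (k + 1)).hom - AddMonoidHom.id _),
    fun x hx => ?_⟩
  have := comm ((e.f (k + 1)).hom x - x)
  rw [map_sub, hee, sub_self, map_sub, hd, hx, sub_self, map_zero, zero_add] at this
  simp only [AddMonoidHom.comp_apply, AddMonoidHom.sub_apply, AddMonoidHom.id_apply]
  rw [eq_neg_of_add_eq_zero_left this.symm]
  abel

lemma exists_hom_of_homotopy_zero {K : ChainComplex AddCommGrpCat.{u} ℕ} (e : K ⟶ K)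
    (h : Homotopy e (𝟙 K)) (x : K.X 0) : ∃ y, x - (K.d 1 0).hom y = (e.f 0).hom x := by
  have comm : (e.f 0).hom x = (K.d 1 0).hom ((h.hom 0 1).hom x) + x := by
    have := h.comm 0
    rw [Homotopy.dNext_zero_chainComplex, zero_add, prevD_eq (j' := 1) (w := by simp)] at this
    exact ConcreteCategory.congr_hom this x
  refine ⟨-(h.hom 0 1).hom x, ?_⟩
  rw [comm, map_neg]
  abel

namespace CategoryTheory.SimplicialObject

/-- The product of two simplicial homotopies. -/
def Homotopy.prod' {C : Type*} [Category* C] {D : Type*} [Category* D] {X Y : SimplicialObject C}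
    {X' Y' : SimplicialObject D} {f g : X ⟶ Y} {f' g' : X' ⟶ Y'} (H : Homotopy f g)
    (H' : Homotopy f' g') :
    SimplicialObject.Homotopy (X := Functor.prod' X X') (Y := Functor.prod' Y Y')
      (NatTrans.prod' f f') (NatTrans.prod' g g') where
  h i := (H.h i, H'.h i)
  h_zero_comp_δ_zero n := Prod.ext (H.h_zero_comp_δ_zero n) (H'.h_zero_comp_δ_zero n)
  h_last_comp_δ_last n := Prod.ext (H.h_last_comp_δ_last n) (H'.h_last_comp_δ_last n)
  h_succ_comp_δ_castSucc_of_lt i j hij := Prod.ext (H.h_succ_comp_δ_castSucc_of_lt i j hij)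
    (H'.h_succ_comp_δ_castSucc_of_lt i j hij)
  h_succ_comp_δ_castSucc_succ j := Prod.ext (H.h_succ_comp_δ_castSucc_succ j)
    (H'.h_succ_comp_δ_castSucc_succ j)
  h_castSucc_comp_δ_succ_of_lt i j hij := Prod.ext (H.h_castSucc_comp_δ_succ_of_lt i j hij)
    (H'.h_castSucc_comp_δ_succ_of_lt i j hij)
  h_comp_σ_castSucc_of_le i j hij := Prod.ext (H.h_comp_σ_castSucc_of_le i j hij)
    (H'.h_comp_σ_castSucc_of_le i j hij)
  h_comp_σ_succ_of_lt i j hij := Prod.ext (H.h_comp_σ_succ_of_lt i j hij)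
    (H'.h_comp_σ_succ_of_lt i j hij)

end CategoryTheory.SimplicialObject

/-! ### The abelian simplicial groups `ℤ[G_*^m] ⊗ A_*` -/

/-- The functor `(G, A) ↦ ℤ[G^m] ⊗ A`. -/
noncomputable def powTensor (m : ℕ) : GrpCat.{u} × AddCommGrpCat.{v} ⥤ AddCommGrpCat.{max u v} where
  obj Z := AddCommGrpCat.of ((Fin m → Z.1) →₀ Z.2)
  map f := AddCommGrpCat.ofHom (Finsupp.bimap (fun y => f.1.hom ∘ y) f.2.hom)
  map_id _ := congrArg AddCommGrpCat.ofHom Finsupp.bimap_id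
  map_comp f g := congrArg AddCommGrpCat.ofHom
    (Finsupp.bimap_comp (fun y => f.1.hom ∘ y) (fun y => g.1.hom ∘ y) f.2.hom g.2.hom)

section

variable (m : ℕ) {G G' G'' : SimplicialObject GrpCat.{u}}
  {A A' A'' : SimplicialObject AddCommGrpCat.{v}}

/-- The abelian simplicial group `ℤ[G_*^m] ⊗ A_*`. -/
noncomputable abbrev powTensorObj (G : SimplicialObject GrpCat.{u})
    (A : SimplicialObject AddCommGrpCat.{v}) : SimplicialObject AddCommGrpCat.{max u v} :=
  ((SimplicialObject.whiskering _ _).obj (powTensor m)).obj (Functor.prod' G A)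

/-- The functoriality of `ℤ[G_*^m] ⊗ A_*`. -/
noncomputable abbrev powTensorMap (f : G ⟶ G') (k : A ⟶ A') :
    powTensorObj m G A ⟶ powTensorObj m G' A' :=
  ((SimplicialObject.whiskering _ _).obj (powTensor m)).map
    (X := Functor.prod' G A) (Y := Functor.prod' G' A') (NatTrans.prod' f k)

lemma powTensorMap_id : powTensorMap m (𝟙 G) (𝟙 A) = 𝟙 _ :=
  ((SimplicialObject.whiskering _ _).obj (powTensor m)).map_id (Functor.prod' G A)

lemma powTensorMap_comp (f : G ⟶ G') (k : A ⟶ A') (f' : G' ⟶ G'') (k' : A' ⟶ A'') :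
    powTensorMap m (f ≫ f') (k ≫ k') = powTensorMap m f k ≫ powTensorMap m f' k' :=
  ((SimplicialObject.whiskering _ _).obj (powTensor m)).map_comp
    (X := Functor.prod' G A) (Y := Functor.prod' G' A') (Z := Functor.prod' G'' A'')
    (NatTrans.prod' f k) (NatTrans.prod' f' k')

/-- The chain homotopy between endomorphisms of `ℤ[G_*^m] ⊗ A_*` induced by a homotopy. -/
noncomputable def powTensorHomotopy {f g : G ⟶ G'} (H : SimplicialObject.Homotopy f g) :
    Homotopy ((alternatingFaceMapComplex _).map (powTensorMap m f (𝟙 A)))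
      ((alternatingFaceMapComplex _).map (powTensorMap m g (𝟙 A))) :=
  -- The homotopy is constant on the coefficients, and no linearity in the group variable is needed
  -- since any functor preserves simplicial homotopies.
  ((H.prod' (SimplicialObject.Homotopy.refl (𝟙 A))).whiskerRight (powTensor m)).toChainHomotopy

lemma alternatingFaceMapComplex_d_apply (A : SimplicialObject AddCommGrpCat.{v}) (k : ℕ)
    (a : A _⦋k + 1⦌) : (((alternatingFaceMapComplex _).obj A).d (k + 1) k).hom a =
      ∑ i : Fin (k + 2), (-1 : ℤ) ^ (i : ℕ) • (A.δ i).hom a := by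
  rw [alternatingFaceMapComplex_obj_d]
  exact AddCommGrpCat.hom_sum_apply _ _ _

/-- Over a constant simplicial group the faces act on the coefficients alone. -/
lemma powTensorObj_const_d_apply (Q : Type u) [Group Q] (k : ℕ)
    (w : (Fin m → Q) →₀ A _⦋k + 1⦌) (t : Fin m → Q) :
    DFunLike.coe (F := (Fin m → Q) →₀ A _⦋k⦌) ((((alternatingFaceMapComplex _).obj
      (powTensorObj m ((Functor.const _).obj (GrpCat.of Q)) A)).d (k + 1) k).hom w) t =
      (((alternatingFaceMapComplex _).obj A).d (k + 1) k).hom (w t) := by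
  rw [alternatingFaceMapComplex_d_apply]
  refine (congrArg (fun z => DFunLike.coe (F := (Fin m → Q) →₀ A _⦋k⦌) z t)
    (alternatingFaceMapComplex_d_apply
      (powTensorObj m ((Functor.const _).obj (GrpCat.of Q)) A) k w)).trans ?_
  refine (Finsupp.finsetSum_apply _ _ _).trans ?_
  refine Finset.sum_congr rfl fun i _ => ?_
  refine (Finsupp.smul_apply _ _ _).trans ?_
  congr 1
  exact Finsupp.bimap_id_apply (A.δ i).hom w t

end

/-! ### Reduction of coefficients and of the simplicial group -/

/-- The normalized chains of an abelian simplicial group. -/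
noncomputable def normalizedChains (A : SimplicialObject AddCommGrpCat.{v}) (k : ℕ) :
    AddSubgroup (A _⦋k⦌) :=
  ((DoldKan.PInfty (X := A)).f k).hom.range

lemma mem_normalizedChains_iff (A : SimplicialObject AddCommGrpCat.{v}) (k : ℕ) (a : A _⦋k⦌) :
    a ∈ normalizedChains A k ↔ ((DoldKan.PInfty (X := A)).f k).hom a = a := by
  refine ⟨?_, fun h => ⟨a, h⟩⟩
  rintro ⟨b, rfl⟩
  exact ConcreteCategory.congr_hom (DoldKan.PInfty_f_idem (X := A) k) b

lemma d_mem_normalizedChains (A : SimplicialObject AddCommGrpCat.{v}) (k : ℕ) (a : A _⦋k + 1⦌)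
    (ha : a ∈ normalizedChains A (k + 1)) :
    (((alternatingFaceMapComplex _).obj A).d (k + 1) k).hom a ∈ normalizedChains A k := by
  rw [mem_normalizedChains_iff] at ha ⊢
  have := ConcreteCategory.congr_hom ((DoldKan.PInfty (X := A)).comm (k + 1) k) a
  refine this.symm.trans ?_
  exact congrArg _ ha

section

variable (m : ℕ) {G : SimplicialObject GrpCat.{u}} {A : SimplicialObject AddCommGrpCat.{v}}
  {Q : Type u} [Group Q] (s : (Functor.const _).obj (GrpCat.of Q) ⟶ G)

/-- The subcomplex `ℤ[Q^m] ⊗ N(A_*)` of `ℤ[G_*^m] ⊗ A_*`, where `N(A_*)` are the normalized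
chains. -/
noncomputable def powTensorReduced (A : SimplicialObject AddCommGrpCat.{v}) (k : ℕ) :
    AddSubgroup ((Fin m → G _⦋k⦌) →₀ A _⦋k⦌) :=
  (Finsupp.bimap (fun y : Fin m → Q => (s.app (op ⦋k⦌)).hom ∘ y)
    (normalizedChains A k).subtype).range

/-- Membership becomes a condition on each coefficient. In the converse direction `PInfty`, which
fixes normalized chains, retracts the coefficients to the subgroup. -/
lemma mem_powTensorReduced_iff (k : ℕ) (z : (Fin m → G _⦋k⦌) →₀ A _⦋k⦌) :
    z ∈ powTensorReduced m s A k ↔ ∃ w : (Fin m → Q) →₀ A _⦋k⦌,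
      (∀ t, w t ∈ normalizedChains A k) ∧
        Finsupp.bimap (fun y : Fin m → Q => (s.app (op ⦋k⦌)).hom ∘ y) (AddMonoidHom.id _) w = z := by
  constructor
  · rintro ⟨v, rfl⟩
    refine ⟨Finsupp.bimap id (normalizedChains A k).subtype v, fun t => ?_, ?_⟩
    · rw [Finsupp.bimap_id_apply]
      exact (v t).2
    · rw [Finsupp.bimap_bimap]
      rfl
  · rintro ⟨w, hw, rfl⟩
    let P : A _⦋k⦌ →+ normalizedChains A k := ((DoldKan.PInfty (X := A)).f k).hom.rangeRestrict
    refine ⟨Finsupp.bimap id P w, ?_⟩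
    rw [Finsupp.bimap_bimap]
    have : w = Finsupp.bimap id ((DoldKan.PInfty (X := A)).f k).hom w := by
      ext t
      rw [Finsupp.bimap_id_apply]
      exact ((mem_normalizedChains_iff A k _).mp (hw t)).symm
    conv_rhs => rw [this, Finsupp.bimap_bimap]
    rfl

lemma d_mem_powTensorReduced (k : ℕ)
    (z : ((alternatingFaceMapComplex _).obj (powTensorObj m G A)).X (k + 1))
    (hz : z ∈ powTensorReduced m s A (k + 1)) :
    (((alternatingFaceMapComplex _).obj (powTensorObj m G A)).d (k + 1) k).hom z ∈
      powTensorReduced m s A k := by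
  obtain ⟨w, hw, rfl⟩ := (mem_powTensorReduced_iff m s (k + 1) _).mp hz
  refine (mem_powTensorReduced_iff m s k _).mpr ⟨(((alternatingFaceMapComplex _).obj
    (powTensorObj m ((Functor.const _).obj (GrpCat.of Q)) A)).d (k + 1) k).hom w, fun t => ?_,
    (ConcreteCategory.congr_hom (((alternatingFaceMapComplex _).map
      (powTensorMap m s (𝟙 A))).comm (k + 1) k) w).symm⟩
  have := powTensorObj_const_d_apply (A := A) m Q k w t
  exact Set.mem_of_eq_of_mem this (d_mem_normalizedChains A k _ (hw t))

variable (p : G ⟶ (Functor.const _).obj (GrpCat.of Q))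
  (H : SimplicialObject.Homotopy (𝟙 G) (p ≫ s))

include H

lemma exists_sub_d_mem_powTensorReduced_zero
    (z : ((alternatingFaceMapComplex _).obj (powTensorObj m G A)).X 0) :
    ∃ y, z - (((alternatingFaceMapComplex _).obj (powTensorObj m G A)).d 1 0).hom y ∈
      powTensorReduced m s A 0 := by
  obtain ⟨y, hy⟩ := exists_hom_of_homotopy_zero
    ((alternatingFaceMapComplex _).map (powTensorMap m (p ≫ s) (𝟙 A)))
    ((powTensorHomotopy m H).symm.trans (Homotopy.ofEq (by rw [powTensorMap_id]; rfl))) z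
  refine ⟨y, ?_⟩
  rw [hy]
  refine (mem_powTensorReduced_iff m s 0 _).mpr
    ⟨Finsupp.bimap (fun y => (p.app (op ⦋0⦌)).hom ∘ y) (AddMonoidHom.id _) z, fun t => ?_, ?_⟩
  -- In degree zero `PInfty` is the identity, so every coefficient is already normalized.
  · rw [mem_normalizedChains_iff]
    rfl
  · exact Finsupp.bimap_bimap _ _ _ _ _

/-- Two corrections by boundaries: the deformation of `G` moves the chain into `ℤ[Q^m] ⊗ A_*`, then
the homotopy from `PInfty` to the identity, applied to each coefficient, normalizes it. Both are
available because the boundary of `z` is fixed by both idempotents. -/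
lemma exists_sub_d_mem_powTensorReduced_succ (hsp : s ≫ p = 𝟙 _) (k : ℕ)
    (z : ((alternatingFaceMapComplex _).obj (powTensorObj m G A)).X (k + 1))
    (hz : (((alternatingFaceMapComplex _).obj (powTensorObj m G A)).d (k + 1) k).hom z ∈
      powTensorReduced m s A k) :
    ∃ y, z - (((alternatingFaceMapComplex _).obj (powTensorObj m G A)).d (k + 2) (k + 1)).hom y ∈
      powTensorReduced m s A (k + 1) := by
  let σ := (alternatingFaceMapComplex _).map (powTensorMap m s (𝟙 A))
  let ρ := (alternatingFaceMapComplex _).map (powTensorMap m p (𝟙 A))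
  have hρσ : (alternatingFaceMapComplex _).map (powTensorMap m (p ≫ s) (𝟙 A)) = ρ ≫ σ := by
    rw [← Functor.map_comp, ← powTensorMap_comp, Category.comp_id]
  have hσρ : σ ≫ ρ = 𝟙 _ := by
    rw [← Functor.map_comp, ← powTensorMap_comp, Category.comp_id, hsp, powTensorMap_id]
    exact CategoryTheory.Functor.map_id _ _
  have hσρ' : ∀ k x, (ρ.f k).hom ((σ.f k).hom x) = x := fun k x =>
    ConcreteCategory.congr_hom (HomologicalComplex.congr_hom hσρ k) x
  have hσd : ∀ k x, (((alternatingFaceMapComplex _).obj (powTensorObj m G A)).d (k + 1) k).hom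
      ((σ.f (k + 1)).hom x) = (σ.f k).hom ((((alternatingFaceMapComplex _).obj
        (powTensorObj m _ A)).d (k + 1) k).hom x) := fun k x =>
    ConcreteCategory.congr_hom (σ.comm (k + 1) k) x
  obtain ⟨w₀, hw₀, e₀⟩ := (mem_powTensorReduced_iff m s k _).mp hz
  change (σ.f k).hom w₀ = _ at e₀
  obtain ⟨g, hg⟩ := exists_add_hom_of_homotopy (ρ ≫ σ)
    (by rw [Category.assoc, reassoc_of% hσρ])
    ((Homotopy.ofEq hρσ.symm).trans ((powTensorHomotopy m H).symm.trans
      (Homotopy.ofEq (by rw [powTensorMap_id]; rfl)))) k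
  replace hg := hg z (by
    rw [← e₀]
    exact congrArg (σ.f k).hom (hσρ' k w₀))
  obtain ⟨g', hg'⟩ := exists_add_hom_of_homotopy (DoldKan.PInfty (X := A))
    DoldKan.PInfty_idem (DoldKan.homotopyPInftyToId A) k
  let w := (ρ.f (k + 1)).hom z
  have hdw : (((alternatingFaceMapComplex _).obj (powTensorObj m
      ((Functor.const _).obj (GrpCat.of Q)) A)).d (k + 1) k).hom w = w₀ := by
    rw [← hσρ' k w₀, e₀]
    exact (ConcreteCategory.congr_hom (ρ.comm (k + 1) k) z)
  let y' : (Fin m → Q) →₀ A _⦋k + 2⦌ := Finsupp.bimap id g' w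
  refine ⟨g z + (σ.f (k + 2)).hom y', (mem_powTensorReduced_iff m s (k + 1) _).mpr
    ⟨w - (((alternatingFaceMapComplex _).obj (powTensorObj m
      ((Functor.const _).obj (GrpCat.of Q)) A)).d (k + 2) (k + 1)).hom y', fun t => ?_, ?_⟩⟩
  · have h₁ := powTensorObj_const_d_apply (A := A) m Q (k + 1) y' t
    have h₂ : y' t = g' (DFunLike.coe (F := (Fin m → Q) →₀ A _⦋k + 1⦌) w t) :=
      Finsupp.bimap_id_apply g' w t
    have h₃ := powTensorObj_const_d_apply (A := A) m Q k w t
    rw [h₂] at h₁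
    rw [hdw] at h₃
    have h₄ := (mem_normalizedChains_iff A k _).mp (hw₀ t)
    have h₅ := hg' _ ((congrArg _ h₃.symm).trans (h₄.trans h₃))
    exact ⟨_, ((Finsupp.sub_apply _ _ _).trans ((congrArg (_ - ·) h₁).trans h₅)).symm⟩
  · change (σ.f (k + 1)).hom _ = _
    rw [map_sub, map_add, ← sub_sub]
    exact congrArg₂ (· - ·) hg.symm (hσd (k + 1) y').symm

end

/-! ### Vanishing of homology for simplicial groups with free homotopy type -/

namespace SimplicialAction

variable {G : SimplicialObject GrpCat.{u}} {A : SimplicialObject AddCommGrpCat.{v}}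
  (α : SimplicialAction G A)

/-- The normal form of `B_m(G_*, A_*)`. -/
noncomputable def barToPowTensor (m : ℕ) : α.bar m ⟶ powTensorObj m G A where
  app k := AddCommGrpCat.ofHom (BarTensor.finsuppEquiv (α.act k) m).toAddMonoidHom
  naturality k l f := by
    ext t
    exact BarTensor.finsuppEquiv_map (G.map f).hom (A.map f).hom (α.map_act f) t

/-! ### The normalized coefficients as modules over a group of vertices -/

section

variable {Q : Type u} [Group Q] (s : (Functor.const _).obj (GrpCat.of Q) ⟶ G)

/-- The endomorphism of an abelian simplicial group given by the action of a group of vertices. -/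
noncomputable def constEnd (q : Q) : A ⟶ A where
  app n := AddCommGrpCat.ofHom (α.act n ((s.app n).hom q))
  naturality n l f := by
    ext a
    have h₁ := α.map_act f ((s.app n).hom q) a
    have h₂ : (G.map f).hom ((s.app n).hom q) = (s.app l).hom q :=
      (ConcreteCategory.congr_hom (s.naturality f) q).symm
    rw [← h₂]
    exact h₁.symm

/-- A constant family of vertices acts by a simplicial endomorphism, and `PInfty` is natural. -/
lemma act_mem_normalizedChains (q : Q) (k : ℕ) (a : A _⦋k⦌) (ha : a ∈ normalizedChains A k) :
    α.act (op ⦋k⦌) ((s.app (op ⦋k⦌)).hom q) a ∈ normalizedChains A k := by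
  rw [mem_normalizedChains_iff] at ha ⊢
  have := ConcreteCategory.congr_hom (DoldKan.PInfty_f_naturality k (α.constEnd s q)) a
  exact this.trans (congrArg _ ha)

/-- The action on the normalized chains of a group of vertices. -/
noncomputable def normalizedAct (k : ℕ) : Q →* AddMonoid.End (normalizedChains A k) where
  toFun q :=
    { toFun := fun a => ⟨α.act (op ⦋k⦌) ((s.app (op ⦋k⦌)).hom q) a.1,
        α.act_mem_normalizedChains s q k a.1 a.2⟩
      map_zero' := Subtype.ext (map_zero _)
      map_add' := fun _ _ => Subtype.ext (map_add _ _ _) }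
  map_one' := by
    ext a
    change α.act (op ⦋k⦌) ((s.app (op ⦋k⦌)).hom 1) a.1 = a.1
    rw [map_one, map_one]
    rfl
  map_mul' q q' := by
    ext a
    change α.act (op ⦋k⦌) ((s.app (op ⦋k⦌)).hom (q * q')) a.1 =
      α.act (op ⦋k⦌) ((s.app (op ⦋k⦌)).hom q) (α.act (op ⦋k⦌) ((s.app (op ⦋k⦌)).hom q') a.1)
    rw [map_mul, map_mul]
    rfl

/-- The inclusion of `B_m(Q) ⊗_Q N(A_*)` into `B_m(G_*, A_*)`. -/
noncomputable def reducedInclusion (m k : ℕ) :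
    BarTensor (α.normalizedAct s k) m →+ BarTensor (α.act (op ⦋k⦌)) m :=
  BarTensor.map (s.app (op ⦋k⦌)).hom (normalizedChains A k).subtype (fun _ _ => rfl) m

/-- The image of `B_m(Q) ⊗_Q N(A_*)` in `B_m(G_*, A_*)`. -/
noncomputable def reduced (m k : ℕ) : AddSubgroup (BarTensor (α.act (op ⦋k⦌)) m) :=
  (α.reducedInclusion s m k).range

lemma mem_reduced_iff (m k : ℕ) (x : BarTensor (α.act (op ⦋k⦌)) m) :
    x ∈ α.reduced s m k ↔
      BarTensor.finsuppEquiv (α.act (op ⦋k⦌)) m x ∈ powTensorReduced m s A k := by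
  constructor
  · rintro ⟨l, rfl⟩
    exact ⟨_, (BarTensor.finsuppEquiv_map (φ := α.normalizedAct s k) (s.app (op ⦋k⦌)).hom
      (normalizedChains A k).subtype (fun _ _ => rfl) l).symm⟩
  · rintro ⟨w, hw⟩
    obtain ⟨l, rfl⟩ := (BarTensor.finsuppEquiv (α.normalizedAct s k) m).surjective w
    refine ⟨l, (BarTensor.finsuppEquiv _ m).injective ?_⟩
    rw [← hw]
    exact BarTensor.finsuppEquiv_map (φ := α.normalizedAct s k) (s.app (op ⦋k⦌)).hom
      (normalizedChains A k).subtype (fun _ _ => rfl) l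

/-- Clear in normal form. It is needed so that a horizontal cycle in the image comes from a cycle
over `Q`. -/
lemma reducedInclusion_injective (hs : ∀ k, Function.Injective (s.app (op ⦋k⦌)).hom) (m k : ℕ) :
    Function.Injective (α.reducedInclusion s m k) := by
  intro l l' h
  have e := BarTensor.finsuppEquiv_map (φ := α.normalizedAct s k) (φ' := α.act (op ⦋k⦌)) (m := m)
    (s.app (op ⦋k⦌)).hom (normalizedChains A k).subtype (fun _ _ => rfl)
  apply (BarTensor.finsuppEquiv (α.normalizedAct s k) m).injective
  refine Finsupp.bimap_injective (fun y y' hy => ?_) (normalizedChains A k).subtype_injective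
    ((e l).symm.trans ((congrArg _ h).trans (e l')))
  exact funext fun i => hs k (congrFun hy i)

lemma d_reducedInclusion (m k : ℕ) (l : BarTensor (α.normalizedAct s k) (m + 1)) :
    BarTensor.d (α.act (op ⦋k⦌)) m (α.reducedInclusion s (m + 1) k l) =
      α.reducedInclusion s m k (BarTensor.d _ m l) :=
  DFunLike.congr_fun (BarTensor.map_d (φ := α.normalizedAct s k) (s.app (op ⦋k⦌)).hom
      (normalizedChains A k).subtype (fun _ _ => rfl) m) l

end

lemma bicomplex_d_f (m k : ℕ) : ((α.bicomplex.d (m + 1) m).f k).hom =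
    BarTensor.d (α.act (op ⦋k⦌)) m := by
  have : (ChainComplex.of α.bar α.barD α.barD_comp_barD).d (m + 1) m = α.barD m :=
    ChainComplex.of_d _ _ _
  change (((alternatingFaceMapComplex AddCommGrpCat.{max u v}).map
    ((ChainComplex.of α.bar α.barD α.barD_comp_barD).d (m + 1) m)).f k).hom = _
  rw [this]
  rfl

lemma exists_d_eq_of_mem_reduced {S : Type u}
    (s : (Functor.const _).obj (GrpCat.of (FreeGroup S)) ⟶ G)
    (hs : ∀ k, Function.Injective (s.app (op ⦋k⦌)).hom) (m k : ℕ)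
    (x : BarTensor (α.act (op ⦋k⦌)) (m + 2)) (hx : x ∈ α.reduced s (m + 2) k)
    (h : BarTensor.d (α.act (op ⦋k⦌)) (m + 1) x = 0) :
    ∃ y ∈ α.reduced s (m + 3) k, BarTensor.d (α.act (op ⦋k⦌)) (m + 2) y = x := by
  obtain ⟨l, rfl⟩ := hx
  rw [d_reducedInclusion] at h
  obtain ⟨y, rfl⟩ := BarTensor.exists_d_eq_of_freeGroup (α.normalizedAct s k) m l
    (α.reducedInclusion_injective s hs _ _ (h.trans (map_zero _).symm))
  exact ⟨_, ⟨y, rfl⟩, d_reducedInclusion _ _ _ _ _⟩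

/-- If a simplicial group is homotopy equivalent to a free group through homomorphisms, and the
normalized chains of the coefficients are concentrated in degrees zero and one, then the homology
vanishes in degrees at least three, and in degree two if the coefficients are discrete. -/
theorem isZero_homology {S : Type u} (s : (Functor.const _).obj (GrpCat.of (FreeGroup S)) ⟶ G)
    (p : G ⟶ (Functor.const _).obj (GrpCat.of (FreeGroup S))) (hsp : s ≫ p = 𝟙 _)
    (H : SimplicialObject.Homotopy (𝟙 G) (p ≫ s))
    (hA : ∀ k, normalizedChains A (k + 2) = ⊥) (n : ℕ)
    (hn : n = 0 → normalizedChains A 1 = ⊥) : IsZero (α.homology (n + 2)) := by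
  have hs : ∀ k, Function.Injective (s.app (op ⦋k⦌)).hom := fun k =>
    Function.LeftInverse.injective (g := (p.app (op ⦋k⦌)).hom) fun q =>
      ConcreteCategory.congr_hom (NatTrans.congr_app hsp (op ⦋k⦌)) q
  have hbot : ∀ m k, normalizedChains A k = ⊥ → ∀ x ∈ α.reduced s m k, x = 0 := by
    intro m k hk x hx
    rw [mem_reduced_iff, mem_powTensorReduced_iff] at hx
    obtain ⟨w, hw, e⟩ := hx
    obtain rfl : w = 0 := by
      ext t
      have := hw t
      rw [hk] at this
      exact this
    rw [map_zero] at e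
    exact (BarTensor.finsuppEquiv _ m).injective (e.symm.trans (map_zero _).symm)
  have hθ : ∀ m k x, BarTensor.finsuppEquiv (α.act (op ⦋k⦌)) m
      (((α.bicomplex.X m).d (k + 1) k).hom x) =
      (((alternatingFaceMapComplex _).obj (powTensorObj m G A)).d (k + 1) k).hom
        (BarTensor.finsuppEquiv (α.act (op ⦋k + 1⦌)) m x) := fun m k x =>
    (ConcreteCategory.congr_hom (((alternatingFaceMapComplex _).map
      (α.barToPowTensor m)).comm (k + 1) k) x).symm
  let dv : ∀ m k, BarTensor (α.act (op ⦋k + 1⦌)) m →+ BarTensor (α.act (op ⦋k⦌)) m := fun m k =>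
    ((α.bicomplex.X m).d (k + 1) k).hom
  -- The sign of the vertical differential is an involution; it is absorbed in the witnesses below.
  have hunit : ∀ (m k l : ℕ) (x : BarTensor (α.act (op ⦋k⦌)) l),
      (-1 : ℤ) ^ m • ((-1 : ℤ) ^ m • x) = x := fun m k l x => by
    rw [smul_smul, ← mul_pow]; simp
  have hdvv : ∀ m k x, dv m k (dv m (k + 1) x) = 0 := fun m k x =>
    ConcreteCategory.congr_hom ((α.bicomplex.X m).d_comp_d (k + 2) (k + 1) k) x
  have hcomm : ∀ m k x, BarTensor.d (α.act (op ⦋k⦌)) m (dv (m + 1) k x) =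
      dv m k (BarTensor.d (α.act (op ⦋k + 1⦌)) m x) := fun m k x => by
    rw [← bicomplex_d_f, ← bicomplex_d_f]
    exact (ConcreteCategory.congr_hom ((α.bicomplex.d (m + 1) m).comm (k + 1) k) x).symm
  have hSv : ∀ m k, ∀ x ∈ α.reduced s m (k + 1), dv m k x ∈ α.reduced s m k := fun m k x hx => by
    rw [mem_reduced_iff] at hx ⊢
    exact Set.mem_of_eq_of_mem (hθ m k x) (d_mem_powTensorReduced m s k _ hx)
  refine α.bicomplex.isZero_homology_total (n + 1) fun x hx => ?_
  obtain ⟨y, hy⟩ := exists_total_boundary (D := fun m k => BarTensor (α.act (op ⦋k⦌)) m)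
    (fun m k => BarTensor.d (α.act (op ⦋k⦌)) m) (fun m k => (-1 : ℤ) ^ m • dv m k)
    (fun m k x => DFunLike.congr_fun (BarTensor.d_comp_d (α.act (op ⦋k⦌)) m) x)
    (fun m k x => by
      simp only [AddMonoidHom.smul_apply, map_zsmul, hdvv, smul_zero])
    (fun m k x => by
      simp only [AddMonoidHom.smul_apply, map_zsmul, hcomm, pow_succ]
      simp)
    (fun m k => α.reduced s m k)
    (fun m k x hx => by
      obtain ⟨l, rfl⟩ := hx
      exact ⟨_, (d_reducedInclusion _ _ _ _ _).symm⟩)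
    (fun m k x hx => (α.reduced s m k).zsmul_mem (hSv m k x hx) _)
    (fun m x => by
      obtain ⟨y, hy⟩ := exists_sub_d_mem_powTensorReduced_zero m s p H
        (BarTensor.finsuppEquiv (α.act (op ⦋0⦌)) m x)
      obtain ⟨y, rfl⟩ := (BarTensor.finsuppEquiv (α.act (op ⦋1⦌)) m).surjective y
      refine ⟨(-1 : ℤ) ^ m • y, ?_⟩
      rw [mem_reduced_iff, AddMonoidHom.smul_apply, map_zsmul, hunit, map_sub]
      exact Set.mem_of_eq_of_mem (congrArg (_ - ·) (hθ m 0 y)) hy)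
    (fun m k x hx => by
      replace hx := (α.reduced s m k).zsmul_mem hx ((-1) ^ m)
      rw [AddMonoidHom.smul_apply, hunit, mem_reduced_iff] at hx
      obtain ⟨y, hy⟩ := exists_sub_d_mem_powTensorReduced_succ m s p H hsp k
        (BarTensor.finsuppEquiv (α.act (op ⦋k + 1⦌)) m x)
        (Set.mem_of_eq_of_mem (hθ m k x).symm hx)
      obtain ⟨y, rfl⟩ := (BarTensor.finsuppEquiv (α.act (op ⦋k + 2⦌)) m).surjective y
      refine ⟨(-1 : ℤ) ^ m • y, ?_⟩
      rw [mem_reduced_iff, AddMonoidHom.smul_apply, map_zsmul, hunit, map_sub]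
      exact Set.mem_of_eq_of_mem (congrArg (_ - ·) (hθ m (k + 1) y)) hy)
    (fun m k => hbot m (k + 2) (hA k)) n
    (fun x hx h => α.exists_d_eq_of_mem_reduced s hs n 0 x hx h)
    (fun x hx h => by
      cases n with
      -- In total degree two, row 1 would contribute first homology of the free group, which need
      -- not vanish; hence the condition `hn`.
      | zero => exact ⟨0, zero_mem _, by rw [map_zero, hbot 1 1 (hn rfl) x hx]⟩
      | succ n => exact α.exists_d_eq_of_mem_reduced s hs n 1 x hx h)
    x (fun m k h => by
      rw [← bicomplex_d_f]
      exact hx m k h)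
  refine ⟨y, fun m k h => ?_⟩
  rw [bicomplex_d_f]
  exact hy m k h

end SimplicialAction

/-! ### Free crossed modules -/

namespace CrossedModule

namespace Hom

variable {H G H' G' H'' G'' : Type*} [Group H] [Group G] [Group H'] [Group G'] [Group H'']
  [Group G'']

/-- The identity morphism. -/
protected def id (X : CrossedModule H G) : Hom X X where
  top := MonoidHom.id H
  bot := MonoidHom.id G
  comm _ := rfl
  equivariant _ _ := rfl

/-- The composition of morphisms of crossed modules. -/
def comp {X : CrossedModule H G} {Y : CrossedModule H' G'} {Z : CrossedModule H'' G''}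
    (ψ : Hom Y Z) (φ : Hom X Y) : Hom X Z where
  top := ψ.top.comp φ.top
  bot := ψ.bot.comp φ.bot
  comm h := by simp [φ.comm, ψ.comm]
  equivariant g h := by simp [φ.equivariant, ψ.equivariant]

end Hom

section FreeModel

variable (S : Type u)

/-- The action of the free group on `S` on the free group on its product with `S`. -/
def freeAct : FreeGroup S →* MulAut (FreeGroup (FreeGroup S × S)) where
  toFun q := FreeGroup.freeGroupCongr ((Equiv.mulLeft q).prodCongr (Equiv.refl S))
  map_one' := by
    apply MulEquiv.toMonoidHom_injective
    ext ⟨q', s⟩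
    simp
  map_mul' q₁ q₂ := by
    apply MulEquiv.toMonoidHom_injective
    ext ⟨q', s⟩
    simp [mul_assoc]

@[simp]
lemma freeAct_of (q q' : FreeGroup S) (s : S) :
    freeAct S q (FreeGroup.of (q', s)) = FreeGroup.of (q * q', s) := by
  simp [freeAct]

/-- An explicit free crossed module on `S`: the kernel of a retraction of free groups. -/
def freeModel : CrossedModule (FreeGroup (FreeGroup S × S))
    (FreeGroup (FreeGroup S × S) ⋊[freeAct S] FreeGroup S) where
  μ := SemidirectProduct.inl
  act := SemidirectProduct.lift MulAut.conj (freeAct S) fun q => by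
    ext h x : 2
    simp
  precrossed g h := by
    ext <;> simp [SemidirectProduct.lift, mul_assoc]
  peiffer h h' := by simp

variable {S} {H G : Type*} [Group H] [Group G] (X : CrossedModule H G) (ι : S → H × G)

/-- The second component of the morphism from the free model on the free group on `S`. -/
def freeModelLiftRight : FreeGroup S →* G := FreeGroup.lift fun s => (ι s).2

/-- The first component of the morphism from the free model. -/
def freeModelLiftTop : FreeGroup (FreeGroup S × S) →* H :=
  FreeGroup.lift fun x => X.act (freeModelLiftRight ι x.1) (ι x.2).1

lemma freeModelLiftTop_freeAct (q : FreeGroup S) (h : FreeGroup (FreeGroup S × S)) :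
    X.freeModelLiftTop ι (freeAct S q h) =
      X.act (freeModelLiftRight ι q) (X.freeModelLiftTop ι h) := by
  refine DFunLike.congr_fun (f := (X.freeModelLiftTop ι).comp (freeAct S q).toMonoidHom)
    (g := (X.act (freeModelLiftRight ι q)).toMonoidHom.comp (X.freeModelLiftTop ι))
    (FreeGroup.ext_hom _ _ fun x => ?_) h
  obtain ⟨q', s⟩ := x
  simp [freeModelLiftTop]

/-- The morphism from the free model with prescribed values on generators. -/
def freeModelLift : Hom (freeModel S) X where
  top := X.freeModelLiftTop ι
  bot := SemidirectProduct.lift (X.μ.comp (X.freeModelLiftTop ι)) (freeModelLiftRight ι) fun q => by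
    refine MonoidHom.ext fun h => ?_
    simp [freeModelLiftTop_freeAct, X.precrossed]
  comm h := by simp [freeModel]
  equivariant g h := by
    simp [freeModel, SemidirectProduct.lift, freeModelLiftTop_freeAct, X.peiffer]

end FreeModel

/-- A free crossed module is the kernel of a split epimorphism onto a free group. -/
lemma IsFree.exists_splitting {H G : Type u} [Group H] [Group G] {X : CrossedModule H G}
    (hX : X.IsFree) : ∃ (S : Type u) (π : G →* FreeGroup S) (σ : FreeGroup S →* G),
      (∀ q, π (σ q) = q) ∧ Function.Injective X.μ ∧ ∀ g, π g = 1 ↔ ∃ h, X.μ h = g := by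
  obtain ⟨S, ι, hι⟩ := hX
  -- Freeness of `X` gives `φ`, and the explicit lift gives `ψ` with `ψ φ = 1` by uniqueness. So `X`
  -- is a retract of the model and inherits its properties; the freeness of the model itself is not
  -- needed.
  obtain ⟨φ, hφ, -⟩ := hι _ _ (freeModel S)
    (fun s => (FreeGroup.of (1, s), SemidirectProduct.inr (FreeGroup.of s)))
  simp only [Prod.mk.injEq] at hφ
  let ψ := X.freeModelLift ι
  have hψφ : ψ.comp φ = Hom.id X := by
    refine (hι _ _ X ι).unique (fun s => ?_) (fun s => rfl)
    simp [Hom.comp, hφ, ψ, freeModelLift, freeModelLiftTop, freeModelLiftRight]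
  have htop : ∀ h, ψ.top (φ.top h) = h := fun h => DFunLike.congr_fun (congrArg Hom.top hψφ) h
  have hbot : ∀ g, ψ.bot (φ.bot g) = g := fun g => DFunLike.congr_fun (congrArg Hom.bot hψφ) g
  refine ⟨S, SemidirectProduct.rightHom.comp φ.bot, freeModelLiftRight ι, fun q => ?_, ?_,
    fun g => ⟨fun h => ?_, ?_⟩⟩
  · refine DFunLike.congr_fun (f := (SemidirectProduct.rightHom.comp φ.bot).comp
      (freeModelLiftRight ι)) (g := MonoidHom.id _) (FreeGroup.ext_hom _ _ fun s => ?_) q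
    simp [freeModelLiftRight, hφ]
  · rw [injective_iff_map_eq_one]
    intro h e
    have := φ.comm h
    rw [e, map_one] at this
    have := SemidirectProduct.inl_injective (this.symm.trans (map_one _).symm)
    rw [← htop h, this, map_one]
  -- If `π g = 1`, then `φ.bot g` has trivial right component, so it is the image of its left
  -- component; `ψ` carries this back to `X`.
  · refine ⟨ψ.top (φ.bot g).left, ?_⟩
    rw [← ψ.comm, ← hbot g]
    congr 1
    ext
    · simp [freeModel, hbot]
    · simpa [freeModel, hbot] using h.symm
  · rintro ⟨h, rfl⟩
    rw [MonoidHom.comp_apply, φ.comm]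
    rfl

end CrossedModule

/-! ### The nerve of a crossed module -/

lemma val_succAbove {n : ℕ} (i : Fin (n + 1)) (j : Fin n) :
    (i.succAbove j : ℕ) = if (j : ℕ) < i then (j : ℕ) else j + 1 := by
  simp only [Fin.succAbove, Fin.lt_def, Fin.val_castSucc]
  split_ifs <;> rfl

lemma val_predAbove {n : ℕ} (i : Fin n) (j : Fin (n + 1)) :
    (i.predAbove j : ℕ) = if (i : ℕ) < j then (j : ℕ) - 1 else j := by
  simp only [Fin.predAbove, Fin.lt_def, Fin.val_castSucc]
  split_ifs <;> rfl

/-- The vertices of a simplex `(x₀, …, xᵢ, e, …, e)`. -/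
def prismObj {G : Type*} {n : ℕ} (i : Fin (n + 1)) (o : Fin (n + 1) → G) (e : G)
    (j : Fin (n + 2)) : G :=
  if h : (j : ℕ) ≤ i then o ⟨j, lt_of_le_of_lt h i.2⟩ else e

lemma prismObj_of_le {G : Type*} {n : ℕ} (i : Fin (n + 1)) (o : Fin (n + 1) → G) (e : G)
    (j : Fin (n + 2)) (l : Fin (n + 1)) (h : (j : ℕ) ≤ i) (hl : (l : ℕ) = j) :
    prismObj i o e j = o l := by
  rw [prismObj, dif_pos h]
  congr 1
  exact Fin.ext hl.symm

lemma prismObj_of_lt {G : Type*} {n : ℕ} (i : Fin (n + 1)) (o : Fin (n + 1) → G) (e : G)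
    (j : Fin (n + 2)) (h : (i : ℕ) < j) : prismObj i o e j = e := by
  rw [prismObj, dif_neg (not_le.mpr h)]

/-- Reduces each simplicial identity for the prisms to arithmetic of indices. -/
lemma prismObj_congr {G : Type*} {n n' : ℕ} (i : Fin (n + 1)) (i' : Fin (n' + 1))
    (o : Fin (n + 1) → G) (o' : Fin (n' + 1) → G) (e : G) (j : Fin (n + 2)) (j' : Fin (n' + 2))
    (h : (j : ℕ) ≤ i ↔ (j' : ℕ) ≤ i')
    (ho : ∀ (l : Fin (n + 1)) (l' : Fin (n' + 1)), (j : ℕ) ≤ i → (l : ℕ) = j → (l' : ℕ) = j' →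
      o l = o' l') :
    prismObj i o e j = prismObj i' o' e j' := by
  unfold prismObj
  by_cases hj : (j : ℕ) ≤ i
  · rw [dif_pos hj, dif_pos (h.mp hj)]
    exact ho _ _ hj rfl rfl
  · rw [dif_neg hj, dif_neg (mt h.mpr hj)]

namespace CrossedModule

namespace Nerve

variable {H G : Type*} [Group H] [Group G] {X : CrossedModule H G} {n : ℕ}

/-- With `μ` injective, an arrow is determined by its two ends. -/
lemma ext_obj (hX : Function.Injective X.μ) {x y : Nerve X n} (h : ∀ i, x.obj i = y.obj i) :
    x = y := by
  ext i
  · exact h i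
  · rename_i i j hij
    apply hX
    rw [eq_mul_inv_of_mul_eq (x.target i j hij), eq_mul_inv_of_mul_eq (y.target i j hij), h, h]

/-- If `μ` is injective, a simplex of the nerve is a family of congruent vertices. -/
noncomputable def ofObj (hX : Function.Injective X.μ) (o : Fin (n + 1) → G)
    (ho : ∀ i j, ∃ h, X.μ h = o i * (o j)⁻¹) : Nerve X n where
  obj := o
  hom i j _ := (ho i j).choose
  target i j _ := by rw [(ho i j).choose_spec, inv_mul_cancel_right]
  comp i j k _ _ := by
    apply hX
    rw [map_mul, (ho i j).choose_spec, (ho j k).choose_spec, (ho i k).choose_spec]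
    group

lemma eq_one_of_obj_zero (x : Nerve X n) (h₀ : x.obj 0 = 1)
    (h : ∀ i, x.hom 0 i (Fin.zero_le i) = 1) : x = 1 := by
  ext i
  · have := x.target 0 i (Fin.zero_le i)
    rwa [h, map_one, one_mul, h₀] at this
  · rename_i i j hij
    have := x.comp 0 i j (Fin.zero_le i) hij
    rwa [h, h, one_mul] at this

end Nerve

section

variable {H G : Type u} [Group H] [Group G] (X : CrossedModule H G) {Q : Type u} [Group Q]
  (π : G →* Q) (σ : Q →* G)

/-- The inclusion of a group of vertices into the nerve. -/
def nerveConst : (Functor.const _).obj (GrpCat.of Q) ⟶ X.nerve where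
  app n := GrpCat.ofHom
    { toFun := fun q =>
        { obj := fun _ => σ q
          hom := fun _ _ _ => 1
          target := fun _ _ _ => by simp
          comp := fun _ _ _ _ _ => by simp }
      map_one' := by ext <;> simp
      map_mul' := fun q q' => by ext <;> simp }
  naturality _ _ _ := rfl

variable {X π} (hπ : ∀ h, π (X.μ h) = 1)

include hπ in
lemma map_obj_eq {n : ℕ} (x : Nerve X n) (i : Fin (n + 1)) : π (x.obj i) = π (x.obj 0) := by
  rw [← x.target 0 i (Fin.zero_le i), map_mul, hπ, one_mul]

/-- The projection of the nerve onto a quotient group of the group of components. -/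
def nerveProj : X.nerve ⟶ (Functor.const _).obj (GrpCat.of Q) where
  app n := GrpCat.ofHom
    { toFun := fun x : Nerve X n.unop.len => π (x.obj 0)
      map_one' := map_one π
      map_mul' := fun _ _ => map_mul π _ _ }
  naturality n m f := by
    ext x
    exact map_obj_eq hπ (n := n.unop.len) x _

lemma nerveConst_nerveProj (h : ∀ q, π (σ q) = q) :
    X.nerveConst σ ≫ nerveProj hπ = 𝟙 _ := by
  ext n q
  exact h q

/-- The homomorphisms `(x₀, …, xₙ) ↦ (x₀, …, xᵢ, e, …, e)` with `e = σ (π x₀)`. -/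
noncomputable def nervePrism (hX : Function.Injective X.μ) (hσ : ∀ q, π (σ q) = q)
    (hμ : ∀ g, π g = 1 → ∃ h, X.μ h = g) {n : ℕ} (i : Fin (n + 1)) :
    Nerve X n →* Nerve X (n + 1) where
  toFun x := Nerve.ofObj hX (prismObj i x.obj (σ (π (x.obj 0)))) fun j k => hμ _ (by
    have : ∀ j, π (prismObj i x.obj (σ (π (x.obj 0))) j) = π (x.obj 0) := fun j => by
      unfold prismObj
      split_ifs
      · exact map_obj_eq hπ x _
      · exact hσ _
    rw [map_mul, map_inv, this, this, mul_inv_cancel])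
  map_one' := Nerve.ext_obj hX fun j => by
    simp [Nerve.ofObj, prismObj]
  map_mul' x y := Nerve.ext_obj hX fun j => by
    simp only [Nerve.ofObj, prismObj, Nerve.mul_obj, map_mul]
    split_ifs <;> rfl

/-- The nerve of a crossed module with injective `μ` deforms onto the group of components if the
latter splits off. -/
noncomputable def nerveHomotopy (hX : Function.Injective X.μ) (hσ : ∀ q, π (σ q) = q)
    (hμ : ∀ g, π g = 1 → ∃ h, X.μ h = g) :
    SimplicialObject.Homotopy (𝟙 X.nerve) (nerveProj hπ ≫ X.nerveConst σ) where
  h i := GrpCat.ofHom (nervePrism σ hπ hX hσ hμ i)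
  h_zero_comp_δ_zero n := by
    ext x
    refine Nerve.ext_obj (n := n) hX fun j => ?_
    have hj : ((0 : Fin (n + 1)) : ℕ) < Fin.succAbove 0 j := by simp
    exact prismObj_of_lt _ x.obj _ (Fin.succAbove 0 j) hj
  h_last_comp_δ_last n := by
    ext x
    refine Nerve.ext_obj (n := n) hX fun j => ?_
    have hj : ((Fin.last (n + 1)).succAbove j : ℕ) = j := by simp
    exact prismObj_of_le _ _ _ ((Fin.last (n + 1)).succAbove j) j (hj.le.trans j.is_le) hj.symm
  h_succ_comp_δ_castSucc_of_lt {n} i j hij := by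
    ext x
    refine Nerve.ext_obj (n := n + 1) hX fun l => ?_
    change prismObj j.succ x.obj (σ (π (x.obj 0))) (i.castSucc.succAbove l) =
      prismObj j (fun l => x.obj (i.succAbove l)) (σ (π (x.obj (i.succAbove 0)))) l
    -- The face may omit the vertex 0 from which the filling vertex `e` is computed, but all
    -- vertices have the same image under `π`.
    rw [map_obj_eq hπ x (i.succAbove 0)]
    refine prismObj_congr _ _ _ _ _ _ _ ?_ fun a b h ha hb => congrArg x.obj (Fin.ext ?_)
    all_goals
      simp only [val_succAbove, Fin.val_succ, Fin.val_castSucc, Fin.le_def] at * <;> split_ifs at * <;> omega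
  h_succ_comp_δ_castSucc_succ {n} j := by
    ext x
    refine Nerve.ext_obj (n := n + 1) hX fun l => ?_
    change prismObj j.succ x.obj (σ (π (x.obj 0))) (j.castSucc.succ.succAbove l) =
      prismObj j.castSucc x.obj (σ (π (x.obj 0))) (j.castSucc.succ.succAbove l)
    refine prismObj_congr _ _ _ _ _ _ _ ?_ fun a b h ha hb => congrArg x.obj (Fin.ext ?_)
    all_goals
      simp only [val_succAbove, Fin.val_succ, Fin.val_castSucc] at * <;> split_ifs at * <;> omega
  h_castSucc_comp_δ_succ_of_lt {n} i j hij := by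
    ext x
    refine Nerve.ext_obj (n := n + 1) hX fun l => ?_
    change prismObj j.castSucc x.obj (σ (π (x.obj 0))) (i.succ.succAbove l) =
      prismObj j (fun l => x.obj (i.succAbove l)) (σ (π (x.obj (i.succAbove 0)))) l
    rw [map_obj_eq hπ x (i.succAbove 0)]
    refine prismObj_congr _ _ _ _ _ _ _ ?_ fun a b h ha hb => congrArg x.obj (Fin.ext ?_)
    all_goals
      simp only [val_succAbove, Fin.val_succ, Fin.val_castSucc, Fin.lt_def] at * <;> split_ifs at * <;> omega
  h_comp_σ_castSucc_of_le {n} i j hij := by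
    ext x
    refine Nerve.ext_obj (n := n + 2) hX fun l => ?_
    change prismObj j x.obj (σ (π (x.obj 0))) (i.castSucc.predAbove l) =
      prismObj j.succ (fun l => x.obj (i.predAbove l)) (σ (π (x.obj (i.predAbove 0)))) l
    rw [map_obj_eq hπ x (i.predAbove 0)]
    refine prismObj_congr _ _ _ _ _ _ _ ?_ fun a b h ha hb => congrArg x.obj (Fin.ext ?_)
    all_goals
      simp only [val_predAbove, Fin.val_succ, Fin.val_castSucc, Fin.le_def] at * <;> split_ifs at * <;> omega
  h_comp_σ_succ_of_lt {n} i j hij := by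
    ext x
    refine Nerve.ext_obj (n := n + 2) hX fun l => ?_
    change prismObj j x.obj (σ (π (x.obj 0))) (i.succ.predAbove l) =
      prismObj j.castSucc (fun l => x.obj (i.predAbove l)) (σ (π (x.obj (i.predAbove 0)))) l
    rw [map_obj_eq hπ x (i.predAbove 0)]
    refine prismObj_congr _ _ _ _ _ _ _ ?_ fun a b h ha hb => congrArg x.obj (Fin.ext ?_)
    all_goals
      simp only [val_predAbove, Fin.val_succ, Fin.val_castSucc, Fin.le_def] at * <;> split_ifs at * <;> omega

end

/-! ### Normalized chains of the nerve -/

lemma δ_eq_zero_of_mem_normalizedChains {A : SimplicialObject AddCommGrpCat.{v}} {k : ℕ}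
    {a : A _⦋k + 1⦌} (ha : a ∈ normalizedChains A (k + 1)) (j : Fin (k + 1)) :
    (A.δ j.succ).hom a = 0 := by
  obtain ⟨b, rfl⟩ := ha
  exact ConcreteCategory.congr_hom
    (DoldKan.HigherFacesVanish.of_P (k + 1) k (X := A) j (by omega)) b

section

variable {M P : Type v} [Group M] [Group P] {Y : CrossedModule M P} (hY : Y.IsAbelian)

lemma map_δ_eq_one_of_mem_normalizedChains {k : ℕ} {a : Nerve Y (k + 1)}
    (ha : (Additive.ofMul a : (Y.abelianNerve hY) _⦋k + 1⦌) ∈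
      normalizedChains (Y.abelianNerve hY) (k + 1)) (j : Fin (k + 1)) :
    Nerve.map j.succ.succAboveOrderEmb.toOrderHom a = 1 :=
  δ_eq_zero_of_mem_normalizedChains ha j

/-- All faces of a normalized chain except the zeroth are trivial. The first of these shows that
vertex 0 is trivial, so only the arrows between vertex 0 and the others remain to be checked. -/
lemma normalizedChains_abelianNerve (k : ℕ) (h : k = 0 → Subsingleton M) :
    normalizedChains (Y.abelianNerve hY) (k + 1) = ⊥ := by
  rw [eq_bot_iff]
  intro a ha
  have key := map_δ_eq_one_of_mem_normalizedChains hY (a := Additive.toMul a) ha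
  have h₀ : (Additive.toMul a : Nerve Y (k + 1)).obj 0 = 1 := congrFun (congrArg Nerve.obj (key 0)) 0
  refine Nerve.eq_one_of_obj_zero (n := k + 1) (Additive.toMul a) h₀ fun i => ?_
  cases k with
  | zero => exact (h rfl).elim _ _
  | succ k =>
    -- In degree at least two there are two positive vertices, so some face other than the zeroth
    -- retains both 0 and `i`.
    obtain ⟨j, hj⟩ : ∃ j : Fin (k + 2), j.succ ≠ i := by
      by_cases hi : (0 : Fin (k + 2)).succ = i
      · exact ⟨1, fun h => by simpa using Fin.succ_injective _ (hi.trans h.symm)⟩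
      · exact ⟨0, hi⟩
    obtain ⟨l, rfl⟩ := Fin.exists_succAbove_eq hj.symm
    have := congrFun (congrFun (congrFun (congrArg Nerve.hom (key j)) 0) l) (Fin.zero_le l)
    simpa using this

end

end CrossedModule

theorem mainTheorem11 {R F : Type u} [Group R] [Group F] (X : CrossedModule R F) (hX : X.IsFree) :
    (∀ {C A : Type v} [Group C] [Group A] (Y : CrossedModule C A) (hY : Y.IsAbelian)
        (a : X.Action Y) (n : ℕ), 3 ≤ n → IsZero (X.homology Y hY a n)) ∧
      ∀ n : ℕ, 2 ≤ n → IsZero (X.integralHomology n) := by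
  obtain ⟨S, π, σ, hσ, hinj, hμ⟩ := hX.exists_splitting
  have hπ : ∀ h, π (X.μ h) = 1 := fun h => (hμ _).mpr ⟨h, rfl⟩
  refine ⟨fun {C A} _ _ Y hY a n hn => ?_, fun n hn => ?_⟩
  · obtain ⟨n, rfl⟩ := Nat.exists_eq_add_of_le' hn
    exact (a.nerve hY).isZero_homology (X.nerveConst σ) (CrossedModule.nerveProj hπ)
      (CrossedModule.nerveConst_nerveProj σ hπ hσ)
      (CrossedModule.nerveHomotopy σ hπ hinj hσ fun g => (hμ g).mp)
      -- Degree `n + 3` is read as `(n + 1) + 2`, so the condition on the normalized chains of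
      -- degree one is vacuous.
      (fun k => CrossedModule.normalizedChains_abelianNerve hY (k + 1) (by simp)) (n + 1) (by simp)
  · obtain ⟨n, rfl⟩ := Nat.exists_eq_add_of_le' hn
    exact ((CrossedModule.Action.trivial X _).nerve CrossedModule.isAbelian_integers).isZero_homology
      (X.nerveConst σ) (CrossedModule.nerveProj hπ)
      (CrossedModule.nerveConst_nerveProj σ hπ hσ)
      (CrossedModule.nerveHomotopy σ hπ hinj hσ fun g => (hμ g).mp)
      (fun k => CrossedModule.normalizedChains_abelianNerve _ (k + 1) (by simp)) n
      -- The top group of `(0, ℤ, 0)` is trivial, so the normalized chains already vanish in degree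
      -- one.
      (fun _ => CrossedModule.normalizedChains_abelianNerve _ 0 fun _ => inferInstance)
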